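/- Let $n\ge 1$, let $I$ be a non-empty smooth one-dimensional manifold without boundary (for instance an open interval or a circle), and let $\mathcal F_{n+2}$ be the manifold of complete flags $V_1\subset V_2\subset\cdots\subset V_{n+1}\subset\mathbf R^{n+2}$, $\dim V_i=i$, with the projection $\pi_1:\mathcal F_{n+2}\to P^{n+1}=\mathrm{Gr}(1,\mathbf R^{n+2})$, $\pi_1(V_1,\dots,V_{n+1})=V_1$. The pseudo-contact distribution $\mathcal D\subset T\mathcal F_{n+2}$ consists of the tangent vectors $v$ at $(V_1,\dots,V_{n+1})$ with $\pi_{1*}(v)\in T\,\mathrm{Gr}(1,V_{n+1})\subset T\,\mathrm{Gr}(1,\mathbf R^{n+2})$. Let $\boldsymbol a=(a_1,\dots,a_{n+1})$ be integers with $1\le a_1<a_2<\cdots<a_{n+1}$. A $C^\infty$ curve $\gamma$ in $\mathbf R^{n+2}\setminus\{0\}$ is of type $\boldsymbol a$ at $t_0$ if, for $1\le i\le n+1$, $a_i$ is the least $k$ for which the matrix $(\gamma(t_0),\gamma'(t_0),\dots,\gamma^{(k)}(t_0))$ has rank $i+1$; a curve in $P^{n+1}$ is of type $\boldsymbol a$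 at $t_0$ if a local $C^\infty$ lift of it to $\mathbf R^{n+2}\setminus\{0\}$ is so (in a local coordinate of $I$). Put $s(\boldsymbol a)=\sum_{i=1}^{n+1}(a_i-i)$. Let $r\ge a_{n+1}$, let $J^r_{\mathcal D}(I,\mathcal F_{n+2})\subset J^r(I,\mathcal F_{n+2})$ be the set of $r$-jets of (germs of) $C^\infty$ curves $\Gamma:I\to\mathcal F_{n+2}$ that are integral to $\mathcal D$, and let $\Sigma_{\mathcal D}(\boldsymbol a)\subset J^r_{\mathcal D}(I,\mathcal F_{n+2})$ be the set of $r$-jets at points $t_0\in I$ of $\mathcal D$-integral curves $\Gamma$ such that $\pi_1\circ\Gamma$ is of type $\boldsymbol a$ at $t_0$. Then $J^r_{\mathcal D}(I,\mathcal F_{n+2})$ and $\Sigma_{\mathcal D}(\boldsymbol a)$ are submanifolds of $J^r(I,\mathcal F_{n+2})$, $\Sigma_{\mathcal D}(\boldsymbol a)$ is non-empty, and the codimension of $\Sigma_{\mathcal D}(\boldsymbol a)$ in $J^r_{\mathcal D}(I,\mathcal F_{n+2})$ is $$\sum_{i=2}^{n+1}(a_i-i)=s(\boldsymbol a)-(a_1-1).$$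 -/

import Mathlib

open scoped Manifold ContDiff

namespace FlagJet

/-! ### Complete flags in `ℝ^{n+2}` and the standard charts of the flag manifold -/

/-- The vector space `ℝ^{n+2}`. -/
abbrev Vec (n : ℕ) : Type := Fin (n + 2) → ℝ

/-- Square matrices of size `n+2`. -/
abbrev Mat (n : ℕ) : Type := Matrix (Fin (n + 2)) (Fin (n + 2)) ℝ

/-- A point of the flag manifold `F_{n+2}`: a complete (non-oriented) flag
`V_1 ⊂ V_2 ⊂ ⋯ ⊂ V_{n+1} ⊂ ℝ^{n+2}` with `dim V_i = i`; here `V_i` is `V (i-1)`. -/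
structure CompleteFlag (n : ℕ) where
  V : Fin (n + 1) → Submodule ℝ (Vec n)
  mono : Monotone V
  finrank_eq : ∀ i, Module.finrank ℝ (V i) = (i : ℕ) + 1

/-- The line `V_1 = π_1(V_1, …, V_{n+1})`. -/
def CompleteFlag.line {n : ℕ} (F : CompleteFlag n) : Submodule ℝ (Vec n) := F.V 0

/-- The span of the first `k` columns of a matrix. -/
def colSpan {n : ℕ} (A : Mat n) (k : ℕ) : Submodule ℝ (Vec n) :=
  Submodule.span ℝ {v | ∃ j : Fin (n + 2), (j : ℕ) < k ∧ v = fun i => A i j}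

/-- The coordinates `x_i^j`, `0 ≤ j < i ≤ n+1`, on an affine cell of the flag manifold. -/
abbrev Coord (n : ℕ) : Type := {p : Fin (n + 2) × Fin (n + 2) // p.2 < p.1} → ℝ

/-- The lower triangular matrix with ones on the diagonal and entries `x_i^j` below it. -/
def lowerMat {n : ℕ} (x : Coord n) : Mat n :=
  Matrix.of fun i j => if h : j < i then x ⟨(i, j), h⟩ else if i = j then 1 else 0

/-- The flag `F` lies in the affine cell around the flag of `g ∈ GL(n+2, ℝ)` and has coordinates
`x` there: `V_i` is spanned by the first `i` columns of `g * lowerMat x`. These cells, for all `g`,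
are the charts that define the smooth structure of the flag manifold. -/
def IsChartCoord {n : ℕ} (g : GL (Fin (n + 2)) ℝ) (x : Coord n) (F : CompleteFlag n) : Prop :=
  ∀ i : Fin (n + 1), F.V i = colSpan ((g : Mat n) * lowerMat x) ((i : ℕ) + 1)

/-- In the chart given by `g`, a vector that spans the line `V_1` of the flag with coordinates `x`;
thus `x ↦ [lineVec g x]` is the expression of `π_1 : F_{n+2} → P^{n+1}`. -/
def lineVec {n : ℕ} (g : GL (Fin (n + 2)) ℝ) (x : Coord n) : Vec n :=
  fun i => ((g : Mat n) * lowerMat x) i 0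

/-- The pseudo-contact distribution `D` at the flag with coordinates `x` in the chart given by `g`,
as a subspace of the tangent space (identified with `Coord n` by the chart): those tangent vectors
whose image under `dπ_1` is tangent to `Gr(1, V_{n+1})`. Recall that the tangent space of
`Gr(1, ℝ^{n+2})` at a line `ℓ` is `Hom(ℓ, ℝ^{n+2}/ℓ)` and that of `Gr(1, V_{n+1})` is the subspace
`Hom(ℓ, V_{n+1}/ℓ)`. -/
noncomputable def pseudoContact {n : ℕ} (g : GL (Fin (n + 2)) ℝ) (x : Coord n) :
    Submodule ℝ (Coord n) :=
  (colSpan ((g : Mat n) * lowerMat x) (n + 1)).comap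
    (fderiv ℝ (lineVec g) x : Coord n →ₗ[ℝ] Vec n)

/-! ### Type of a curve -/

/-- The `(n+2) × (r+1)` matrix `(γ(t), γ'(t), …, γ^{(r)}(t))`. -/
noncomputable def derivMatrix {n : ℕ} (γ : ℝ → Vec n) (t : ℝ) (r : ℕ) :
    Matrix (Fin (n + 2)) (Fin (r + 1)) ℝ :=
  Matrix.of fun i k => iteratedDeriv (k : ℕ) γ t i

/-- The curve `γ` in `ℝ^{n+2}` is of type `(a_1, …, a_{n+1})` at `t`; here `a_i` is `a (i-1)`. -/
def IsOfType {n : ℕ} (γ : ℝ → Vec n) (t : ℝ) (a : Fin (n + 1) → ℕ) : Prop :=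
  ∀ i : Fin (n + 1), IsLeast {r : ℕ | (derivMatrix γ t r).rank = (i : ℕ) + 2} (a i)

/-! ### Curves in the flag manifold, parametrised by a one-dimensional manifold `I` -/

section Curves

variable {I : Type*} [TopologicalSpace I] [ChartedSpace ℝ I] {n : ℕ}

/-- On the open set `W` of values of the local coordinate `κ` of `I`, the curve `Γ` has the
smooth expression `u` in the chart of the flag manifold given by `g`. -/
structure IsLocalExpr (Γ : I → CompleteFlag n) (κ : OpenPartialHomeomorph I ℝ)
    (g : GL (Fin (n + 2)) ℝ) (u : ℝ → Coord n) (W : Set ℝ) : Prop where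
  mem_atlas : κ ∈ atlas ℝ I
  isOpen : IsOpen W
  subset : W ⊆ κ.target
  smooth : ContDiffOn ℝ ∞ u W
  expr : ∀ s ∈ W, IsChartCoord g (u s) (Γ (κ.symm s))

/-- `Γ` is a smooth curve near `t`. -/
def SmoothNear (Γ : I → CompleteFlag n) (t : I) : Prop :=
  ∃ κ g u W, IsLocalExpr Γ κ g u W ∧ t ∈ κ.source ∧ κ t ∈ W

/-- `Γ` is, near `t`, a smooth integral curve of the distribution `D`. -/
def IsIntegralNear (Γ : I → CompleteFlag n) (t : I) : Prop :=
  ∃ κ g u W, IsLocalExpr Γ κ g u W ∧ t ∈ κ.source ∧ κ t ∈ W ∧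
    ∀ s ∈ W, deriv u s ∈ pseudoContact g (u s)

/-- The projection `π_1 ∘ Γ`, a curve in `P^{n+1}`, is of type `a` at `t`: in a local coordinate
`κ` of `I` it has a smooth lift `γ` to `ℝ^{n+2} ∖ {0}` near `κ t` that is of type `a` there. -/
def ProjIsOfType (Γ : I → CompleteFlag n) (t : I) (a : Fin (n + 1) → ℕ) : Prop :=
  ∃ κ ∈ atlas ℝ I, t ∈ κ.source ∧ ∃ (W : Set ℝ) (γ : ℝ → Vec n),
    IsOpen W ∧ κ t ∈ W ∧ W ⊆ κ.target ∧ ContDiffOn ℝ ∞ γ W ∧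
    (∀ s ∈ W, γ s ≠ 0 ∧ (Γ (κ.symm s)).line = Submodule.span ℝ {γ s}) ∧
    IsOfType γ (κ t) a

end Curves

/-! ### The jet space `J^r(I, F_{n+2})` -/

section Jets

variable (I : Type*) [TopologicalSpace I] [ChartedSpace ℝ I] (n : ℕ)

/-- A point `t` of `I` with a curve that is smooth near `t`. -/
structure CurveAt where
  t : I
  Γ : I → CompleteFlag n
  smooth : SmoothNear Γ t

variable {I n}

/-- The space of local coordinates of the jet space: the parameter and the derivatives of orders
`0, …, r` of the coordinates of the curve. -/
abbrev JetCoord (n r : ℕ) : Type := ℝ × (Fin (r + 1) → Coord n)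

/-- In the charts `κ` of `I` and `g` of the flag manifold, the `r`-jet of the curve at its base
point has coordinates `x`. -/
def CurveAt.HasJetCoord {r : ℕ} (c : CurveAt I n) (κ : OpenPartialHomeomorph I ℝ)
    (g : GL (Fin (n + 2)) ℝ) (x : JetCoord n r) : Prop :=
  ∃ u W, IsLocalExpr c.Γ κ g u W ∧ c.t ∈ κ.source ∧ κ c.t ∈ W ∧
    x = (κ c.t, fun k : Fin (r + 1) => iteratedDeriv (k : ℕ) u (κ c.t))

variable (I n)

/-- Two curves have the same `r`-jet if they have the same base point and the same value and
derivatives up to order `r` there, in all charts. -/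
def jetSetoid (r : ℕ) : Setoid (CurveAt I n) where
  r c c' := c.t = c'.t ∧ ∀ κ g (x : JetCoord n r), c.HasJetCoord κ g x ↔ c'.HasJetCoord κ g x
  iseqv :=
    { refl := fun _ => ⟨rfl, fun _ _ _ => Iff.rfl⟩
      symm := fun h => ⟨h.1.symm, fun κ g x => (h.2 κ g x).symm⟩
      trans := fun h h' => ⟨h.1.trans h'.1, fun κ g x => (h.2 κ g x).trans (h'.2 κ g x)⟩ }

/-- The jet space `J^r(I, F_{n+2})`. -/
def JetSpace (r : ℕ) : Type _ := Quotient (jetSetoid I n r)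

variable {I n}

/-- The `r`-jet of a curve at its base point. -/
def CurveAt.jet (c : CurveAt I n) (r : ℕ) : JetSpace I n r := Quotient.mk (jetSetoid I n r) c

variable (I n)

/-- The space `J^r_D(I, F_{n+2})` of `r`-jets of `D`-integral curves. -/
def integralJets (r : ℕ) : Set (JetSpace I n r) :=
  {j | ∃ c : CurveAt I n, c.jet r = j ∧ IsIntegralNear c.Γ c.t}

/-- The set `Σ_D(a)` of `r`-jets of `D`-integral curves `Γ` such that `π_1 ∘ Γ` is of type `a`
at the base point. -/
def typeJets (r : ℕ) (a : Fin (n + 1) → ℕ) : Set (JetSpace I n r) :=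
  {j | ∃ c : CurveAt I n, c.jet r = j ∧ IsIntegralNear c.Γ c.t ∧ ProjIsOfType c.Γ c.t a}

variable {I n}

/-- The part of a set of jets that lies in the chart given by `κ` and `g`, in coordinates. -/
def chartImage {r : ℕ} (S : Set (JetSpace I n r)) (κ : OpenPartialHomeomorph I ℝ)
    (g : GL (Fin (n + 2)) ℝ) : Set (JetCoord n r) :=
  {x | ∃ c : CurveAt I n, c.jet r ∈ S ∧ c.HasJetCoord κ g x}

end Jets

/-! ### Submanifolds and codimension -/

/-- `S` is an embedded smooth submanifold of codimension `m` of (an open set of) the normed space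
`E`: locally the zero set of a smooth submersion to `ℝ^m`. -/
def IsSubmanifoldOfCodim {E : Type*} [NormedAddCommGroup E] [NormedSpace ℝ E]
    (S : Set E) (m : ℕ) : Prop :=
  ∀ x ∈ S, ∃ (U : Set E) (f : E → (Fin m → ℝ)), IsOpen U ∧ x ∈ U ∧ ContDiffOn ℝ ∞ f U ∧
    (∀ y ∈ U, Function.Surjective (fderiv ℝ f y)) ∧ S ∩ U = {y ∈ U | f y = 0}

section Codim

variable {I : Type*} [TopologicalSpace I] [ChartedSpace ℝ I] {n r : ℕ}

/-- `S` is an embedded smooth submanifold of codimension `m` of the jet space: it is so in all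
charts. -/
def IsJetSubmanifold (S : Set (JetSpace I n r)) (m : ℕ) : Prop :=
  ∀ κ ∈ atlas ℝ I, ∀ g : GL (Fin (n + 2)) ℝ, IsSubmanifoldOfCodim (chartImage S κ g) m

/-- `S` and `M` are submanifolds of the jet space, `S ⊆ M`, and `S` has codimension `c` in `M`. -/
def HasCodimIn (S M : Set (JetSpace I n r)) (c : ℤ) : Prop :=
  S ⊆ M ∧ ∃ m k : ℕ, IsJetSubmanifold M m ∧ IsJetSubmanifold S k ∧ (k : ℤ) - (m : ℤ) = c

end Codim

/-- The Schubert number `s(a) = ∑_{i=1}^{n+1} (a_i - i)`. -/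
def schubertNumber {n : ℕ} (a : Fin (n + 1) → ℕ) : ℤ :=
  ∑ i : Fin (n + 1), ((a i : ℤ) - ((i : ℕ) + 1 : ℤ))

end FlagJet

/-!
Fix a chart of the flag manifold with coordinates `x_i^j`. The coefficients of the linear form with
kernel `V_{n+1}` can replace the coordinates `x_{n+1}^j`, `1 ≤ j ≤ n`; after this change, and with
`z = x_{n+1}^0`, the distribution `D` is given by the contact equation `dz + ∑ y_j dx_j = 0`, where
`x` and `z` are affine coordinates of the line `V_1` and the remaining coordinates are free. The
derivatives of order `< r` of this equation along a curve are `r` equations on its `r`-jet, each of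
them solvable for a derivative of `z`. They characterize the jets of integral curves: subtracting
from the `z`-coordinate of the Taylor curve the primitive of its contact form gives an integral
curve, and does not change the jet.

The line has type `a` if and only if its derivatives of orders `0, a_1, …, a_{n+1}` are linearly
independent and each derivative whose order `c` lies in a gap, `c < a_i` and `c` not one of the
`a_l`, depends on the preceding ones; a gap order `c` with exactly `i - 1` of the `a_l` below it
thus imposes `n + 2 - i` conditions. In total there are `s(a)` conditions, one for each `i` and
each gap order below `a_i`. The `a_1 - 1` conditions on the derivatives of `z` of order below
`a_1`, where the derivatives of `x` vanish, follow from the contact equations. The others are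
independent on the solutions of the contact equations: some `x`-derivative of order `a_1` does not
vanish, so from this order on the linearized contact equations can be solved for the derivatives
of `y`, which do not enter the type conditions, and the derivatives of `x` and `z` are free.
-/

namespace FlagJet

section Submersions

variable {E F : Type*} [NormedAddCommGroup E] [NormedSpace ℝ E]
  [NormedAddCommGroup F] [NormedSpace ℝ F]

theorem surjective_fderiv_of_hasDerivAt_line {f : E → F} {x : E} (hf : DifferentiableAt ℝ f x)
    (h : ∀ η : F, ∃ δ : E, HasDerivAt (fun s : ℝ => f (x + s • δ)) η 0) :
    Function.Surjective (fderiv ℝ f x) := fun η => by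
  obtain ⟨δ, hδ⟩ := h η
  exact ⟨δ, (hf.hasFDerivAt.hasLineDerivAt δ).unique hδ⟩

theorem surjective_fderiv_of_rightInverse {f : E → F} {g : F → E} {x : E}
    (hf : DifferentiableAt ℝ f x) (hg : DifferentiableAt ℝ g (f x)) (hx : g (f x) = x)
    (hfg : Function.RightInverse g f) : Function.Surjective (fderiv ℝ f x) := fun v => by
  have hcomp : HasFDerivAt (f ∘ g) ((fderiv ℝ f x).comp (fderiv ℝ g (f x))) (f x) :=
    HasFDerivAt.comp _ (hx.symm ▸ hf.hasFDerivAt) hg.hasFDerivAt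
  rw [hfg.comp_eq_id] at hcomp
  exact ⟨fderiv ℝ g (f x) v, DFunLike.congr_fun (hcomp.unique (hasFDerivAt_id _)) v⟩

theorem eventually_surjective [FiniteDimensional ℝ F] {X : Type*} [TopologicalSpace X]
    {A : X → E →L[ℝ] F} {x : X} (hA : ContinuousAt A x) (hx : Function.Surjective (A x)) :
    ∀ᶠ y in nhds x, Function.Surjective (A y) := by
  have := FiniteDimensional.complete ℝ F
  obtain ⟨R, hR⟩ := (A x).exists_rightInverse_of_surjective (LinearMap.range_eq_top.2 hx)
  have hcomp : ContinuousAt (fun y => (A y).comp R) x := hA.clm_comp continuousAt_const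
  have hunits : {T : F →L[ℝ] F | IsUnit T} ∈ nhds ((A x).comp R) :=
    Units.isOpen.mem_nhds (hR ▸ isUnit_one)
  filter_upwards [hcomp.eventually hunits] with y ⟨T, hT⟩ η
  refine ⟨R ((T⁻¹ : (F →L[ℝ] F)ˣ).1 η), ?_⟩
  rw [← ContinuousLinearMap.comp_apply, ← hT]
  exact DFunLike.congr_fun T.mul_inv η

theorem isSubmanifoldOfCodim_of_equations {ι : Type*} [Fintype ι] {S : Set E}
    (h : ∀ x ∈ S, ∃ (U : Set E) (f : E → ι → ℝ), IsOpen U ∧ x ∈ U ∧ ContDiff ℝ ∞ f ∧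
      Function.Surjective (fderiv ℝ f x) ∧ S ∩ U = {y ∈ U | f y = 0}) :
    IsSubmanifoldOfCodim S (Fintype.card ι) := by
  intro x hx
  obtain ⟨U, f, hU, hxU, hf, hsurj, hSU⟩ := h x hx
  obtain ⟨V, hV, hVo, hxV⟩ := eventually_nhds_iff.1
    (eventually_surjective (hf.continuous_fderiv (by simp)).continuousAt hsurj)
  let e : (ι → ℝ) ≃L[ℝ] (Fin (Fintype.card ι) → ℝ) :=
    ContinuousLinearEquiv.piCongrLeft ℝ (fun _ => ℝ) (Fintype.equivFin ι)
  refine ⟨U ∩ V, e ∘ f, hU.inter hVo, ⟨hxU, hxV⟩, (e.contDiff.comp hf).contDiffOn,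
    fun y hy => ?_, ?_⟩
  · rw [e.comp_fderiv]
    exact e.surjective.comp (hV y hy.2)
  · ext y
    have hSUy := Set.ext_iff.1 hSU y
    simp only [Set.mem_inter_iff, Set.mem_ofPred_eq, Function.comp_apply,
      EmbeddingLike.map_eq_zero_iff] at hSUy ⊢
    tauto

theorem IsSubmanifoldOfCodim.preimage {S : Set F} {m : ℕ} (hS : IsSubmanifoldOfCodim S m)
    {φ : E → F} (hφ : ContDiff ℝ ∞ φ) (hsurj : ∀ x, Function.Surjective (fderiv ℝ φ x)) :
    IsSubmanifoldOfCodim (φ ⁻¹' S) m := by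
  intro x hx
  obtain ⟨U, f, hU, hxU, hf, hfsurj, hSU⟩ := hS (φ x) hx
  refine ⟨φ ⁻¹' U, f ∘ φ, hU.preimage hφ.continuous, hxU,
    hf.comp hφ.contDiffOn fun _ h => h, fun y hy => ?_, ?_⟩
  · have hfy : DifferentiableAt ℝ f (φ y) :=
      (hf.contDiffAt (hU.mem_nhds hy)).differentiableAt (by simp)
    rw [fderiv_comp y hfy (hφ.differentiable (by simp) y)]
    exact (hfsurj _ hy).comp (hsurj y)
  · ext y
    simpa using Set.ext_iff.1 hSU (φ y)

end Submersions

section Jets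

variable {V V' : Type*} [NormedAddCommGroup V] [NormedSpace ℝ V]
  [NormedAddCommGroup V'] [NormedSpace ℝ V'] {r : ℕ}

theorem iteratedDeriv_clm_comp (L : V →L[ℝ] V') {u : ℝ → V} {s : ℝ} {k : ℕ}
    (hu : ContDiffAt ℝ k u s) :
    iteratedDeriv k (fun t => L (u t)) s = L (iteratedDeriv k u s) := by
  simp only [iteratedDeriv_eq_iteratedFDeriv]
  exact DFunLike.congr_fun (L.iteratedFDeriv_comp_left hu le_rfl) _

theorem iteratedDeriv_comp_congr {θ : V → V'} (hθ : ContDiff ℝ ∞ θ) {u v : ℝ → V} {s t : ℝ} {k : ℕ}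
    (hu : ContDiffAt ℝ ∞ u s) (hv : ContDiffAt ℝ ∞ v t)
    (h : ∀ i ≤ k, iteratedDeriv i u s = iteratedDeriv i v t) :
    iteratedDeriv k (θ ∘ u) s = iteratedDeriv k (θ ∘ v) t := by
  have h0 : u s = v t := by simpa using h 0 (Nat.zero_le _)
  have hk : (k : ℕ∞ω) ≤ ∞ := by exact_mod_cast le_top
  rw [iteratedDeriv_vcomp_eq_sum_orderedFinpartition hθ.contDiffAt hu hk,
    iteratedDeriv_vcomp_eq_sum_orderedFinpartition hθ.contDiffAt hv hk, h0]
  refine Finset.sum_congr rfl fun c _ => congrArg _ (funext fun j => h _ (c.partSize_le j))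

/-- The `r`-jet of the curve `u` at `s`, as the list of its derivatives of orders `0, …, r`. -/
noncomputable def curveJet (r : ℕ) (u : ℝ → V) (s : ℝ) : Fin (r + 1) → V :=
  fun k => iteratedDeriv (k : ℕ) u s

/-- The derivative of order `k` recorded in an `r`-jet, with the value `0` for `k > r`. -/
noncomputable def jetAt (k : ℕ) : (Fin (r + 1) → V) →L[ℝ] V :=
  if h : k < r + 1 then ContinuousLinearMap.proj ⟨k, h⟩ else 0

theorem jetAt_of_le {k : ℕ} (hk : k ≤ r) (w : Fin (r + 1) → V) :
    jetAt k w = w ⟨k, Nat.lt_succ_of_le hk⟩ := by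
  simp [jetAt, Nat.lt_succ_of_le hk]

theorem jetAt_curveJet {k : ℕ} (hk : k ≤ r) (u : ℝ → V) (s : ℝ) :
    jetAt k (curveJet r u s) = iteratedDeriv k u s :=
  jetAt_of_le hk _

theorem contDiffAt_deriv {u : ℝ → V} {s : ℝ}
    (hu : ContDiffAt ℝ ∞ u s) : ContDiffAt ℝ ∞ (deriv u) s := by
  simpa only [fderiv_apply_one_eq_deriv] using
    (hu.fderiv_right (m := ∞) (by simp)).clm_apply (contDiffAt_const (c := (1 : ℝ)))

theorem iteratedDeriv_clm_comp_eq_jetAt (L : V →L[ℝ] V') {u : ℝ → V} {s : ℝ}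
    (hu : ContDiffAt ℝ ∞ u s) {k : ℕ} (hk : k ≤ r) :
    iteratedDeriv k (fun t => L (u t)) s = L (jetAt k (curveJet r u s)) := by
  rw [iteratedDeriv_clm_comp L (hu.of_le (by exact_mod_cast le_top)), jetAt_curveJet hk]

theorem iteratedDeriv_clm_deriv_eq_jetAt (L : V →L[ℝ] V') {u : ℝ → V} {s : ℝ}
    (hu : ContDiffAt ℝ ∞ u s) {k : ℕ} (hk : k < r) :
    iteratedDeriv k (fun t => L (deriv u t)) s = L (jetAt (k + 1) (curveJet r u s)) := by
  rw [iteratedDeriv_clm_comp L ((contDiffAt_deriv hu).of_le (by exact_mod_cast le_top)),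
    ← iteratedDeriv_succ', jetAt_curveJet hk]

/-- The polynomial curve whose `r`-jet at `s` is `w`. -/
noncomputable def taylorCurve (w : Fin (r + 1) → V) (s t : ℝ) : V :=
  ∑ i : Fin (r + 1), ((t - s) ^ (i : ℕ) / ((i : ℕ).factorial : ℝ)) • w i

theorem contDiff_taylorCurve_uncurry (s : ℝ) :
    ContDiff ℝ ∞ (fun p : (Fin (r + 1) → V) × ℝ => taylorCurve p.1 s p.2) :=
  ContDiff.sum fun i _ => ContDiff.smul (by fun_prop) (by fun_prop)

theorem contDiff_taylorCurve (w : Fin (r + 1) → V) (s : ℝ) : ContDiff ℝ ∞ (taylorCurve w s) :=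
  (contDiff_taylorCurve_uncurry s).comp (contDiff_const.prodMk contDiff_id)

theorem iteratedDeriv_sub_pow_div_factorial (m k : ℕ) (s : ℝ) :
    iteratedDeriv k (fun t : ℝ => (t - s) ^ m / (m.factorial : ℝ)) s = if k = m then 1 else 0 := by
  rw [iteratedDeriv_comp_sub_const k (fun t : ℝ => t ^ m / (m.factorial : ℝ)) s]
  beta_reduce
  rw [sub_self, iteratedDeriv_div_const, iteratedDeriv_fun_pow_zero]
  split_ifs
  · exact div_self (Nat.cast_ne_zero.2 (Nat.factorial_ne_zero m))
  · simp

theorem curveJet_taylorCurve (w : Fin (r + 1) → V) (s : ℝ) :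
    curveJet r (taylorCurve w s) s = w := by
  funext k
  have hterm (i : Fin (r + 1)) :
      iteratedDeriv k (fun t => ((t - s) ^ (i : ℕ) / ((i : ℕ).factorial : ℝ)) • w i) s =
        if i = k then w i else 0 := by
    rw [iteratedDeriv_smul_const (by fun_prop), iteratedDeriv_sub_pow_div_factorial]
    simp only [Fin.val_inj, eq_comm (a := k), ite_smul, one_smul, zero_smul]
  unfold curveJet taylorCurve
  rw [iteratedDeriv_fun_sum fun i _ => by fun_prop]
  simp only [hterm, Finset.sum_ite_eq', Finset.mem_univ, if_true]

theorem contDiff_iteratedDeriv_right {f : V × ℝ → V'} (hf : ContDiff ℝ ∞ f) (k : ℕ) :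
    ContDiff ℝ ∞ (fun p : V × ℝ => iteratedDeriv k (fun t => f (p.1, t)) p.2) := by
  induction k with
  | zero => simpa using hf
  | succ k ih =>
    have hsucc : (fun p : V × ℝ => iteratedDeriv (k + 1) (fun t => f (p.1, t)) p.2) = fun p =>
        fderiv ℝ (fun p : V × ℝ => iteratedDeriv k (fun t => f (p.1, t)) p.2) p (0, 1) := by
      funext p
      have hline : HasDerivAt (fun t : ℝ => (p.1, t)) ((0 : V), (1 : ℝ)) p.2 :=
        (hasDerivAt_const _ _).prodMk (hasDerivAt_id _)
      rw [iteratedDeriv_succ]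
      exact (HasFDerivAt.comp_hasDerivAt (f := fun t : ℝ => (p.1, t)) p.2
        ((ih.differentiable (by simp)) p).hasFDerivAt hline).deriv
    rw [hsucc]
    exact (ih.fderiv_right (m := ∞) (by simp)).clm_apply contDiff_const

/-- The map induced by a smooth map on `r`-jets of curves, computed on polynomial
representatives. -/
noncomputable def prolong (r : ℕ) (θ : V → V') (w : Fin (r + 1) → V) : Fin (r + 1) → V' :=
  curveJet r (θ ∘ taylorCurve w 0) 0

theorem contDiff_prolong {θ : V → V'} (hθ : ContDiff ℝ ∞ θ) : ContDiff ℝ ∞ (prolong r θ) := by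
  rw [contDiff_pi]
  intro k
  exact (contDiff_iteratedDeriv_right (hθ.comp (contDiff_taylorCurve_uncurry 0)) k).comp
    (contDiff_id.prodMk contDiff_const)

theorem prolong_curveJet {θ : V → V'} (hθ : ContDiff ℝ ∞ θ) {u : ℝ → V} {s : ℝ}
    (hu : ContDiffAt ℝ ∞ u s) : prolong r θ (curveJet r u s) = curveJet r (θ ∘ u) s := by
  funext k
  refine iteratedDeriv_comp_congr hθ (contDiff_taylorCurve _ _).contDiffAt hu fun i hi => ?_
  exact congrFun (curveJet_taylorCurve (curveJet r u s) 0) ⟨i, by omega⟩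

theorem leftInverse_prolong {θ : V → V'} {θ' : V' → V} (hθ : ContDiff ℝ ∞ θ)
    (hθ' : ContDiff ℝ ∞ θ') (h : Function.LeftInverse θ' θ) :
    Function.LeftInverse (prolong r θ') (prolong r θ) := fun w => by
  rw [prolong.eq_def r θ w, prolong_curveJet hθ' (hθ.comp (contDiff_taylorCurve w 0)).contDiffAt,
    ← Function.comp_assoc, h.comp_eq_id, Function.id_comp, curveJet_taylorCurve]

end Jets

section AdaptedSequences

variable {K V : Type*} [Field K] [AddCommGroup V] [Module K V] {m : ℕ}

/-- The osculating space of order `k` of a sequence of vectors (in the application, of the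
derivatives of a curve): the span of its terms of index at most `k`. -/
def osculatingSpan (K : Type*) {V : Type*} [Field K] [AddCommGroup V] [Module K V] (v : ℕ → V)
    (k : ℕ) : Submodule K V :=
  Submodule.span K (v '' Set.Iic k)

theorem osculatingSpan_mono (v : ℕ → V) : Monotone (osculatingSpan K v) := fun _ _ h =>
  Submodule.span_mono (Set.image_mono (Set.Iic_subset_Iic.2 h))

theorem apply_mem_osculatingSpan (v : ℕ → V) {c k : ℕ} (h : c ≤ k) : v c ∈ osculatingSpan K v k :=
  Submodule.subset_span (Set.mem_image_of_mem v h)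

instance (v : ℕ → V) (k : ℕ) : FiniteDimensional K (osculatingSpan K v k) :=
  FiniteDimensional.span_of_finite K ((Set.finite_Iic k).image v)

/-- The terms of the sequence `v` whose indices are the values of `b` are linearly independent, and
every earlier term depends on those among them that precede it: `b` lists the places where the
osculating spaces of `v` grow. -/
def IsAdapted (K : Type*) {V : Type*} [Field K] [AddCommGroup V] [Module K V] (v : ℕ → V)
    (b : Fin m → ℕ) : Prop :=
  LinearIndependent K (v ∘ b) ∧
    ∀ j, ∀ c < b j, v c ∈ Submodule.span K (v ∘ b '' Set.Iio j)

theorem IsAdapted.congr {v v' : ℕ → V} {b : Fin m → ℕ} {N : ℕ} (hb : ∀ j, b j ≤ N)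
    (h : ∀ k ≤ N, v k = v' k) (hv : IsAdapted K v b) : IsAdapted K v' b := by
  have hvb : v ∘ b = v' ∘ b := funext fun j => h _ (hb j)
  refine ⟨hvb ▸ hv.1, fun j c hc => ?_⟩
  rw [← hvb, ← h c (hc.le.trans (hb j))]
  exact hv.2 j c hc

theorem isAdapted_comp_iff {W : Type*} [AddCommGroup W] [Module K W] {L : V →ₗ[K] W}
    (hL : Function.Injective L) {v : ℕ → V} {b : Fin m → ℕ} :
    IsAdapted K (L ∘ v) b ↔ IsAdapted K v b := by
  refine and_congr (L.linearIndependent_iff (LinearMap.ker_eq_bot.2 hL)) ?_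
  refine forall₃_congr fun j c _ => ?_
  rw [Function.comp_assoc, Set.image_comp, ← Submodule.map_span]
  exact hL.mem_set_image

theorem osculatingSpan_eq_span_image {v : ℕ → V} {b : Fin m → ℕ} (hb : Monotone b) {j : Fin m}
    (h : ∀ c < b j, v c ∈ Submodule.span K (v ∘ b '' Set.Iio j)) :
    osculatingSpan K v (b j) = Submodule.span K (v ∘ b '' Set.Iic j) := by
  apply le_antisymm
  · rw [osculatingSpan, Submodule.span_le]
    rintro _ ⟨c, hc, rfl⟩
    obtain rfl | hc := (Set.mem_Iic.1 hc).eq_or_lt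
    · exact Submodule.subset_span ⟨j, Set.self_mem_Iic, rfl⟩
    · exact Submodule.span_mono (Set.image_mono Set.Iio_subset_Iic_self) (h c hc)
  · rw [Submodule.span_le]
    rintro _ ⟨i, hi, rfl⟩
    exact apply_mem_osculatingSpan v (hb hi)

theorem finrank_span_image_Iio_le (w : Fin m → V) (j : Fin m) :
    Module.finrank K (Submodule.span K (w '' Set.Iio j)) ≤ j := by
  classical
  have h := finrank_span_finset_le_card (R := K) ((Finset.Iio j).image w)
  rw [Set.finrank, Finset.coe_image, Finset.coe_Iio] at h
  exact h.trans (Finset.card_image_le.trans_eq (Fin.card_Iio j))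

theorem finrank_span_image_Iic {w : Fin m → V} (hw : LinearIndependent K w) (j : Fin m) :
    Module.finrank K (Submodule.span K (w '' Set.Iic j)) = j + 1 := by
  have h := finrank_span_eq_card (hw.comp (Subtype.val : Set.Iic j → Fin m) Subtype.val_injective)
  rw [Set.range_comp, Subtype.range_coe] at h
  rw [h, ← Set.toFinset_card, Set.toFinset_Iic, Fin.card_Iic]

theorem IsAdapted.isLeast_finrank_osculatingSpan {v : ℕ → V} {b : Fin m → ℕ} (hb : Monotone b)
    (h : IsAdapted K v b) (j : Fin m) :
    IsLeast {k | Module.finrank K (osculatingSpan K v k) = j + 1} (b j) := by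
  refine ⟨?_, fun k hk => ?_⟩
  · rw [Set.mem_ofPred_eq, osculatingSpan_eq_span_image hb (h.2 j), finrank_span_image_Iic h.1]
  · by_contra! hlt
    have hle : osculatingSpan K v k ≤ Submodule.span K (v ∘ b '' Set.Iio j) := by
      rw [osculatingSpan, Submodule.span_le]
      rintro _ ⟨c, hc, rfl⟩
      exact h.2 j c (hc.trans_lt hlt)
    have : FiniteDimensional K (Submodule.span K (v ∘ b '' Set.Iio j)) :=
      FiniteDimensional.span_of_finite K (Set.toFinite _)
    have hj := (Submodule.finrank_mono hle).trans (finrank_span_image_Iio_le _ j)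
    rw [Set.mem_ofPred_eq] at hk
    omega

theorem finrank_osculatingSpan_le_of_lt {v : ℕ → V} {k c d : ℕ}
    (h : IsLeast {k | Module.finrank K (osculatingSpan K v k) = d + 1} k) (hc : c < k) :
    Module.finrank K (osculatingSpan K v c) ≤ d := by
  have hle := (Submodule.finrank_mono (osculatingSpan_mono (K := K) v hc.le)).trans_eq h.1
  have hne : Module.finrank K (osculatingSpan K v c) ≠ d + 1 := fun heq => (h.2 heq).not_gt hc
  omega

theorem mem_span_image_Iio_of_isLeast {v : ℕ → V} {b : Fin m → ℕ} (hb : StrictMono b)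
    (h : ∀ j : Fin m, IsLeast {k | Module.finrank K (osculatingSpan K v k) = j + 1} (b j))
    (j : Fin m) : ∀ c < b j, v c ∈ Submodule.span K (v ∘ b '' Set.Iio j) := by
  induction j using WellFoundedLT.induction with
  | ind j ih =>
    intro c hc
    by_cases hj : (j : ℕ) = 0
    · have hzero := finrank_osculatingSpan_le_of_lt (h j) hc
      rw [hj, Nat.le_zero, Submodule.finrank_eq_zero] at hzero
      have hvc := apply_mem_osculatingSpan (K := K) v (le_refl c)
      rw [hzero, Submodule.mem_bot] at hvc
      exact hvc ▸ zero_mem _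
    · let i : Fin m := ⟨j - 1, by omega⟩
      have hi : (i : ℕ) + 1 = j := by simp only [i]; omega
      have hij : i < j := Fin.lt_def.2 (by omega)
      have hd : max c (b i) < b j := max_lt hc (hb hij)
      have heq : osculatingSpan K v (b i) = osculatingSpan K v (max c (b i)) :=
        Submodule.eq_of_le_of_finrank_le (osculatingSpan_mono v (le_max_right _ _))
          (((finrank_osculatingSpan_le_of_lt (h j) hd).trans_eq hi.symm).trans_eq (h i).1.symm)
      have hIic : Set.Iic i ⊆ Set.Iio j := fun x hx => lt_of_le_of_lt hx hij
      have hvc := apply_mem_osculatingSpan (K := K) v (le_max_left c (b i))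
      rw [← heq, osculatingSpan_eq_span_image hb.monotone (ih i hij)] at hvc
      exact Submodule.span_mono (Set.image_mono hIic) hvc

theorem linearIndependent_of_finrank_osculatingSpan {v : ℕ → V} {b : Fin m → ℕ} (hb : Monotone b)
    (hspan : ∀ j, ∀ c < b j, v c ∈ Submodule.span K (v ∘ b '' Set.Iio j))
    (hrank : ∀ j : Fin m, Module.finrank K (osculatingSpan K v (b j)) = j + 1) :
    LinearIndependent K (v ∘ b) := by
  cases m with
  | zero => exact linearIndependent_empty_type
  | succ m =>
    have hlast := hrank (Fin.last m)
    have huniv : Set.Iic (Fin.last m) = Set.univ := Set.eq_univ_of_forall Fin.le_last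
    rw [osculatingSpan_eq_span_image hb (hspan _), huniv, Set.image_univ] at hlast
    rw [linearIndependent_iff_card_eq_finrank_span, Set.finrank, hlast]
    simp

theorem isAdapted_iff_isLeast_finrank {v : ℕ → V} {b : Fin m → ℕ} (hb : StrictMono b) :
    IsAdapted K v b ↔
      ∀ j : Fin m, IsLeast {k | Module.finrank K (osculatingSpan K v k) = j + 1} (b j) := by
  refine ⟨fun h => h.isLeast_finrank_osculatingSpan hb.monotone, fun h => ?_⟩
  have hspan := mem_span_image_Iio_of_isLeast hb h
  exact ⟨linearIndependent_of_finrank_osculatingSpan hb.monotone hspan fun j => (h j).1, hspan⟩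

end AdaptedSequences

section Coordinates

variable {K ι : Type*} [Field K] [Fintype ι] [DecidableEq ι]

theorem mem_span_image_col_iff {A : Matrix ι ι K} (hA : IsUnit A.det) (s : Set ι) (v : ι → K) :
    v ∈ Submodule.span K (A.col '' s) ↔ ∀ i ∉ s, (A⁻¹.mulVec v) i = 0 := by
  constructor
  · intro hv i hi
    induction hv using Submodule.span_induction with
    | mem w hw =>
      obtain ⟨j, hj, rfl⟩ := hw
      rw [← Matrix.mulVec_single_one, Matrix.mulVec_mulVec, Matrix.nonsing_inv_mul _ hA,
        Matrix.one_mulVec, Pi.single_eq_of_ne (ne_of_mem_of_not_mem hj hi).symm]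
    | zero => simp
    | add w w' _ _ hw hw' => rw [Matrix.mulVec_add, Pi.add_apply, hw, hw', add_zero]
    | smul a w _ hw => rw [Matrix.mulVec_smul, Pi.smul_apply, hw, smul_zero]
  · intro h
    have hv : v = A.mulVec (A⁻¹.mulVec v) := by
      rw [Matrix.mulVec_mulVec, Matrix.mul_nonsing_inv _ hA, Matrix.one_mulVec]
    rw [hv, Matrix.mulVec_eq_sum]
    refine Submodule.sum_mem _ fun i _ => ?_
    by_cases hi : i ∈ s
    · rw [op_smul_eq_smul]
      exact Submodule.smul_mem _ _ (Submodule.subset_span (Set.mem_image_of_mem A.col hi))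
    · simp [h i hi]

theorem mem_span_image_col_iff_cramer {A : Matrix ι ι K} (hA : IsUnit A.det) (s : Set ι)
    (v : ι → K) : v ∈ Submodule.span K (A.col '' s) ↔ ∀ i ∉ s, A.cramer v i = 0 := by
  simp only [mem_span_image_col_iff hA, ← Matrix.det_smul_inv_mulVec_eq_cramer A v hA,
    Pi.smul_apply, smul_eq_mul, mul_eq_zero, hA.ne_zero, false_or]

/-- The matrix whose columns are the terms of the sequence `v` with indices `b`. -/
def frameMatrix {m : ℕ} (v : ℕ → Fin m → K) (b : Fin m → ℕ) : Matrix (Fin m) (Fin m) K :=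
  (Matrix.of (v ∘ b)).transpose

theorem cramer_frameMatrix_apply {m : ℕ} (v : ℕ → Fin m → K) (b : Fin m → ℕ) (j : Fin m) :
    (frameMatrix v b).cramer (v (b j)) = Pi.single j (frameMatrix v b).det := by
  rw [frameMatrix, Matrix.det_transpose]
  exact Matrix.cramer_transpose_row_self (Matrix.of (v ∘ b)) j

theorem IsAdapted.isUnit_det_frameMatrix {m : ℕ} {v : ℕ → Fin m → K} {b : Fin m → ℕ}
    (h : IsAdapted K v b) : IsUnit (frameMatrix v b).det :=
  (Matrix.isUnit_iff_isUnit_det _).1 (Matrix.linearIndependent_cols_iff_isUnit.1 h.1)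

theorem isAdapted_iff_cramer {m : ℕ} {v : ℕ → Fin m → K} {b : Fin m → ℕ} (hb : Monotone b)
    (hdet : IsUnit (frameMatrix v b).det) :
    IsAdapted K v b ↔ ∀ i, ∀ c < b i, (frameMatrix v b).cramer (v c) i = 0 := by
  have hmem (j : Fin m) (c : ℕ) : v c ∈ Submodule.span K (v ∘ b '' Set.Iio j) ↔
      ∀ i ∉ Set.Iio j, (frameMatrix v b).cramer (v c) i = 0 :=
    mem_span_image_col_iff_cramer hdet (Set.Iio j) (v c)
  constructor
  · exact fun h i c hc => (hmem i c).1 (h.2 i c hc) i (lt_irrefl i)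
  · refine fun h => ⟨?_, fun j c hc => (hmem j c).2 fun i hi => h i c ?_⟩
    · exact Matrix.linearIndependent_cols_iff_isUnit.2 ((Matrix.isUnit_iff_isUnit_det _).2 hdet)
    · exact hc.trans_le (hb (not_lt.1 hi))

end Coordinates

section SmoothDeterminants

variable {E ι : Type*} [NormedAddCommGroup E] [NormedSpace ℝ E] [Fintype ι] [DecidableEq ι]
  {A : E → Matrix ι ι ℝ}

theorem contDiff_det (hA : ∀ i j, ContDiff ℝ ∞ fun x => A x i j) :
    ContDiff ℝ ∞ fun x => (A x).det := by
  simp only [Matrix.det_apply]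
  exact ContDiff.sum fun σ _ => (contDiff_prod fun i _ => hA _ _).const_smul _

theorem contDiff_cramer (hA : ∀ i j, ContDiff ℝ ∞ fun x => A x i j) {v : E → ι → ℝ}
    (hv : ContDiff ℝ ∞ v) (i : ι) : ContDiff ℝ ∞ fun x => (A x).cramer (v x) i := by
  simp only [Matrix.cramer_apply]
  refine contDiff_det fun j k => ?_
  simp only [Matrix.updateCol_apply]
  split_ifs
  · exact contDiff_pi.1 hv j
  · exact hA j k

end SmoothDeterminants

section FlagCharts

variable {n : ℕ}

theorem lowerMat_of_lt (x : Coord n) {i j : Fin (n + 2)} (h : j < i) :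
    lowerMat x i j = x ⟨(i, j), h⟩ := by
  simp [lowerMat, h]

theorem lowerMat_self (x : Coord n) (i : Fin (n + 2)) : lowerMat x i i = 1 := by
  simp [lowerMat]

theorem lowerMat_of_gt (x : Coord n) {i j : Fin (n + 2)} (h : i < j) : lowerMat x i j = 0 := by
  simp [lowerMat, h.not_gt, h.ne]

theorem det_lowerMat (x : Coord n) : (lowerMat x).det = 1 := by
  rw [Matrix.det_of_isLowerTriangular _ fun i j h => lowerMat_of_gt x h]
  simp [lowerMat_self]

theorem isUnit_det_lowerMat (x : Coord n) : IsUnit (lowerMat x).det :=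
  det_lowerMat x ▸ isUnit_one

theorem isUnit_det_chart (g : GL (Fin (n + 2)) ℝ) (x : Coord n) :
    IsUnit ((g : Mat n) * lowerMat x).det := by
  rw [Matrix.det_mul]
  exact (Matrix.isUnits_det_units g).mul (isUnit_det_lowerMat x)

theorem colSpan_eq_span_image (A : Mat n) (k : ℕ) :
    colSpan A k = Submodule.span ℝ (A.col '' {j | (j : ℕ) < k}) := by
  unfold colSpan
  congr 1
  ext v
  simp only [Set.mem_ofPred_eq, Set.mem_image, eq_comm (a := v)]
  rfl

theorem colSpan_mono (A : Mat n) : Monotone (colSpan A) := fun k l hkl => by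
  simp only [colSpan_eq_span_image]
  exact Submodule.span_mono (Set.image_mono fun j hj => lt_of_lt_of_le hj hkl)

theorem finrank_colSpan {A : Mat n} (hA : IsUnit A.det) (i : Fin (n + 2)) :
    Module.finrank ℝ (colSpan A (i + 1)) = i + 1 := by
  have hcol : LinearIndependent ℝ A.col :=
    Matrix.linearIndependent_cols_iff_isUnit.2 ((Matrix.isUnit_iff_isUnit_det A).2 hA)
  have hIic : {j : Fin (n + 2) | (j : ℕ) < i + 1} = Set.Iic i := by
    ext j
    simp
  rw [colSpan_eq_span_image, hIic, finrank_span_image_Iic hcol]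

/-- The flag with coordinates `x` in the chart given by `g`. -/
def chartFlag (g : GL (Fin (n + 2)) ℝ) (x : Coord n) : CompleteFlag n where
  V i := colSpan ((g : Mat n) * lowerMat x) ((i : ℕ) + 1)
  mono := fun _ _ h => colSpan_mono _ (Nat.succ_le_succ h)
  finrank_eq i := finrank_colSpan (isUnit_det_chart g x) i.castSucc

theorem isChartCoord_chartFlag (g : GL (Fin (n + 2)) ℝ) (x : Coord n) :
    IsChartCoord g x (chartFlag g x) := fun _ => rfl

/-- The index of the coordinate `x_{i+1}^0`; these coordinates describe the line `V_1`. -/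
def lineIdx (i : Fin (n + 1)) : {p : Fin (n + 2) × Fin (n + 2) // p.2 < p.1} :=
  ⟨(i.succ, 0), Fin.succ_pos i⟩

/-- The index of the coordinate `x_{n+1}^{j+1}`; these coordinates can be traded for the
coefficients of a linear form with kernel `V_{n+1}`, see `straighten`. -/
def dualIdx (j : Fin n) : {p : Fin (n + 2) × Fin (n + 2) // p.2 < p.1} :=
  ⟨(Fin.last (n + 1), j.castSucc.succ), by rw [Fin.lt_def]; simp⟩

theorem lineIdx_injective : Function.Injective (lineIdx (n := n)) := fun i j h => by
  simpa [lineIdx] using h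

theorem dualIdx_injective : Function.Injective (dualIdx (n := n)) := fun i j h => by
  simpa [dualIdx] using h

theorem lineIdx_ne_dualIdx (i : Fin (n + 1)) (j : Fin n) : lineIdx i ≠ dualIdx j := fun h =>
  Fin.succ_ne_zero j.castSucc (congrArg (fun p => p.1.2) h).symm

/-- The vector `(a, x_1^0, …, x_{n+1}^0)`: for `a = 1` it consists of homogeneous coordinates of the
line `V_1` of the flag with coordinates `x`, for `a = 0` of their variation in the direction `x`. -/
def homogVec (a : ℝ) (x : Coord n) : Vec n := Fin.cons a fun i => x (lineIdx i)

theorem homogVec_zero (a : ℝ) (x : Coord n) : homogVec a x 0 = a := rfl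

theorem homogVec_add_smul (a b s : ℝ) (x v : Coord n) :
    homogVec (a + s * b) (x + s • v) = homogVec a x + s • homogVec b v := by
  funext i
  cases i using Fin.cases <;> simp [homogVec]

theorem contDiff_homogVec {E : Type*} [NormedAddCommGroup E] [NormedSpace ℝ E] (a : ℝ)
    {φ : E → Coord n} (hφ : ContDiff ℝ ∞ φ) : ContDiff ℝ ∞ fun e => homogVec a (φ e) := by
  rw [contDiff_pi]
  intro i
  cases i using Fin.cases with
  | zero => exact contDiff_const
  | succ i => exact contDiff_pi.1 hφ (lineIdx i)

theorem lineVec_eq_mulVec (g : GL (Fin (n + 2)) ℝ) (x : Coord n) :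
    lineVec g x = (g : Mat n).mulVec (homogVec 1 x) := by
  have hcol : (lowerMat x).col 0 = homogVec 1 x := by
    funext i
    cases i using Fin.cases with
    | zero => exact lowerMat_self x 0
    | succ i => exact lowerMat_of_lt x (Fin.succ_pos i)
  rw [← hcol]
  rfl

theorem contDiff_lineVec (g : GL (Fin (n + 2)) ℝ) : ContDiff ℝ ∞ (lineVec g) := by
  simp only [funext (lineVec_eq_mulVec g)]
  exact (Matrix.mulVecLin (g : Mat n)).toContinuousLinearMap.contDiff.comp
    (contDiff_homogVec 1 contDiff_id)

theorem fderiv_lineVec (g : GL (Fin (n + 2)) ℝ) (x v : Coord n) :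
    fderiv ℝ (lineVec g) x v = (g : Mat n).mulVec (homogVec 0 v) := by
  have hline : HasLineDerivAt ℝ (lineVec g) ((g : Mat n).mulVec (homogVec 0 v)) x v := by
    have hadd (s : ℝ) :
        lineVec g (x + s • v) = lineVec g x + s • (g : Mat n).mulVec (homogVec 0 v) := by
      simp only [lineVec_eq_mulVec, ← Matrix.mulVec_smul, ← Matrix.mulVec_add,
        ← homogVec_add_smul, mul_zero, add_zero]
    simp only [HasLineDerivAt, hadd]
    simpa using ((hasDerivAt_id (0 : ℝ)).smul_const ((g : Mat n).mulVec (homogVec 0 v))).const_add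
      (lineVec g x)
  have hdiff : DifferentiableAt ℝ (lineVec g) x := (contDiff_lineVec g).differentiable (by simp) x
  exact (hdiff.hasFDerivAt.hasLineDerivAt v).unique hline

theorem lineVec_ne_zero (g : GL (Fin (n + 2)) ℝ) (x : Coord n) : lineVec g x ≠ 0 := by
  rw [lineVec_eq_mulVec]
  intro h
  have hzero := Matrix.mulVec_injective_iff_isUnit.2 g.isUnit
    (h.trans (Matrix.mulVec_zero _).symm)
  exact one_ne_zero (congrFun hzero 0)

theorem IsChartCoord.line_eq {g : GL (Fin (n + 2)) ℝ} {x : Coord n} {F : CompleteFlag n}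
    (h : IsChartCoord g x F) : F.line = Submodule.span ℝ {lineVec g x} := by
  have hzero : {j : Fin (n + 2) | (j : ℕ) < ((0 : Fin (n + 1)) : ℕ) + 1} = {0} := by
    ext j
    rw [Set.mem_ofPred_eq, Set.mem_singleton_iff, Fin.ext_iff, Fin.val_zero, Fin.val_zero]
    omega
  rw [CompleteFlag.line, h 0, colSpan_eq_span_image, hzero, Set.image_singleton]
  rfl

/-- The last row of the inverse of `lowerMat x`: in the frame `g` of a chart, a linear form with
kernel `V_{n+1}`. -/
noncomputable def dualRow (x : Coord n) : Vec n := (lowerMat x)⁻¹ (Fin.last (n + 1))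

theorem dualRow_vecMul (x : Coord n) :
    Matrix.vecMul (dualRow x) (lowerMat x) = Pi.single (Fin.last (n + 1)) 1 := by
  have hrow := congrFun (Matrix.nonsing_inv_mul _ (isUnit_det_lowerMat x)) (Fin.last (n + 1))
  rw [Matrix.mul_apply_eq_vecMul] at hrow
  exact hrow.trans (funext fun _ => Matrix.one_eq_pi_single)

theorem vecMul_lowerMat_last (x : Coord n) (ξ : Vec n) :
    Matrix.vecMul ξ (lowerMat x) (Fin.last (n + 1)) = ξ (Fin.last (n + 1)) := by
  simp [Matrix.vecMul, dotProduct, Fin.sum_univ_castSucc, lowerMat_self,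
    lowerMat_of_gt x (Fin.castSucc_lt_last _)]

theorem dualRow_last (x : Coord n) : dualRow x (Fin.last (n + 1)) = 1 := by
  rw [← vecMul_lowerMat_last x (dualRow x), dualRow_vecMul, Pi.single_eq_same]

theorem mulVec_mem_colSpan_iff (g : GL (Fin (n + 2)) ℝ) (x : Coord n) (v : Vec n) :
    (g : Mat n).mulVec v ∈ colSpan ((g : Mat n) * lowerMat x) (n + 1) ↔ dualRow x ⬝ᵥ v = 0 := by
  have hcoord : ((g : Mat n) * lowerMat x)⁻¹.mulVec ((g : Mat n).mulVec v) =
      (lowerMat x)⁻¹.mulVec v := by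
    rw [Matrix.mulVec_mulVec, Matrix.mul_inv_rev, Matrix.mul_assoc,
      Matrix.nonsing_inv_mul _ (Matrix.isUnits_det_units g), Matrix.mul_one]
  have hlast (i : Fin (n + 2)) :
      i ∉ {j : Fin (n + 2) | (j : ℕ) < n + 1} ↔ i = Fin.last (n + 1) := by
    rw [Set.mem_ofPred_eq, not_lt, Fin.ext_iff, Fin.val_last]
    omega
  rw [colSpan_eq_span_image, mem_span_image_col_iff (isUnit_det_chart g x), hcoord]
  simp only [hlast, forall_eq]
  rfl

theorem mem_pseudoContact_iff (g : GL (Fin (n + 2)) ℝ) (x v : Coord n) :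
    v ∈ pseudoContact g x ↔ v (lineIdx (Fin.last n)) +
      ∑ j : Fin n, dualRow x j.castSucc.succ * v (lineIdx j.castSucc) = 0 := by
  have hdot : dualRow x ⬝ᵥ homogVec 0 v = v (lineIdx (Fin.last n)) +
      ∑ j : Fin n, dualRow x j.castSucc.succ * v (lineIdx j.castSucc) := by
    rw [dotProduct, Fin.sum_univ_succ, Fin.sum_univ_castSucc, Fin.succ_last, dualRow_last,
      homogVec_zero, mul_zero, zero_add, one_mul, add_comm]
    rfl
  rw [pseudoContact, Submodule.mem_comap, ContinuousLinearMap.coe_coe, fderiv_lineVec,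
    mulVec_mem_colSpan_iff, hdot]

end FlagCharts

section Straightening

variable {n : ℕ}

theorem vecMul_congr_off_zero {A : Mat n} (hA : ∀ j ≠ 0, A 0 j = 0) {ξ ξ' : Vec n}
    (h : ∀ i ≠ 0, ξ i = ξ' i) : ∀ j ≠ 0, Matrix.vecMul ξ A j = Matrix.vecMul ξ' A j := by
  intro j hj
  simp only [Matrix.vecMul, dotProduct]
  refine Finset.sum_congr rfl fun i _ => ?_
  obtain rfl | hi := eq_or_ne i 0
  · rw [hA j hj, mul_zero, mul_zero]
  · rw [h i hi]

theorem inv_lowerMat_zero (x : Coord n) : (lowerMat x)⁻¹ 0 = Pi.single 0 1 := by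
  have hrow : lowerMat x 0 = Pi.single 0 1 := by
    funext j
    obtain rfl | hj := eq_or_ne j 0
    · rw [lowerMat_self, Pi.single_eq_same]
    · rw [lowerMat_of_gt x (Fin.pos_iff_ne_zero.2 hj), Pi.single_eq_of_ne hj]
  have hinv := congrFun (Matrix.mul_nonsing_inv _ (isUnit_det_lowerMat x)) 0
  rw [Matrix.mul_apply_eq_vecMul, hrow, Matrix.single_one_vecMul] at hinv
  exact hinv.trans (funext fun _ => Matrix.one_eq_pi_single)

theorem vecMul_lowerMat_eq_off_zero_iff (x : Coord n) {ξ ξ' : Vec n} :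
    (∀ j ≠ 0, Matrix.vecMul ξ (lowerMat x) j = Matrix.vecMul ξ' (lowerMat x) j) ↔
      ∀ j ≠ 0, ξ j = ξ' j := by
  constructor
  · intro h
    have hcancel (η : Vec n) : Matrix.vecMul (Matrix.vecMul η (lowerMat x)) (lowerMat x)⁻¹ = η := by
      rw [Matrix.vecMul_vecMul, Matrix.mul_nonsing_inv _ (isUnit_det_lowerMat x), Matrix.vecMul_one]
    have hinv (j : Fin (n + 2)) (hj : j ≠ 0) : (lowerMat x)⁻¹ 0 j = 0 := by
      rw [inv_lowerMat_zero, Pi.single_eq_of_ne hj]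
    simpa only [hcancel] using vecMul_congr_off_zero hinv h
  · exact vecMul_congr_off_zero fun j hj => lowerMat_of_gt x (Fin.pos_iff_ne_zero.2 hj)

theorem vecMul_lowerMat_castSucc (x : Coord n) (ξ : Vec n) (j : Fin (n + 1)) :
    Matrix.vecMul ξ (lowerMat x) j.castSucc =
      (∑ k : Fin (n + 1), ξ k.castSucc * lowerMat x k.castSucc j.castSucc) +
        ξ (Fin.last (n + 1)) * lowerMat x (Fin.last (n + 1)) j.castSucc := by
  rw [Matrix.vecMul, dotProduct, Fin.sum_univ_castSucc]

theorem dualRow_eq_off_zero_iff (x y : Coord n)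
    (hxy : ∀ (k : Fin (n + 1)) j, lowerMat x k.castSucc j = lowerMat y k.castSucc j) :
    (∀ j ≠ 0, dualRow x j = lowerMat y (Fin.last (n + 1)) j) ↔
      ∀ j : Fin (n + 1), j.castSucc ≠ 0 → lowerMat x (Fin.last (n + 1)) j.castSucc =
        -∑ k : Fin (n + 1), lowerMat y (Fin.last (n + 1)) k.castSucc *
          lowerMat y k.castSucc j.castSucc := by
  rw [← vecMul_lowerMat_eq_off_zero_iff x, dualRow_vecMul, Fin.forall_fin_succ']
  have hlast : Pi.single (M := fun _ => ℝ) (Fin.last (n + 1)) 1 (Fin.last (n + 1)) =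
      Matrix.vecMul (lowerMat y (Fin.last (n + 1))) (lowerMat x) (Fin.last (n + 1)) := by
    rw [vecMul_lowerMat_last, lowerMat_self, Pi.single_eq_same]
  rw [and_iff_left fun _ => hlast]
  refine forall₂_congr fun j _ => ?_
  rw [vecMul_lowerMat_castSucc, lowerMat_self, one_mul,
    Pi.single_eq_of_ne (Fin.castSucc_lt_last j).ne, eq_neg_iff_add_eq_zero, eq_comm, add_comm]
  simp only [hxy]

/-- The change of coordinates that replaces `x_{n+1}^j`, `1 ≤ j ≤ n`, by the coefficients of the
linear form `dualRow` with kernel `V_{n+1}`. In the new coordinates the pseudo-contact distribution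
has the same equation everywhere, see `mem_pseudoContact_iff_straighten`. -/
noncomputable def straighten (x : Coord n) : Coord n := fun p =>
  if p.1.1 = Fin.last (n + 1) ∧ p.1.2 ≠ 0 then dualRow x p.1.2 else x p

/-- The inverse of `straighten`. -/
def unstraighten (y : Coord n) : Coord n := fun p =>
  if p.1.1 = Fin.last (n + 1) ∧ p.1.2 ≠ 0 then
    -∑ k : Fin (n + 1), lowerMat y (Fin.last (n + 1)) k.castSucc * lowerMat y k.castSucc p.1.2
  else y p

theorem straighten_lineIdx (x : Coord n) (i : Fin (n + 1)) :
    straighten x (lineIdx i) = x (lineIdx i) := by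
  simp [straighten, lineIdx]

theorem straighten_dualIdx (x : Coord n) (j : Fin n) :
    straighten x (dualIdx j) = dualRow x j.castSucc.succ := by
  simp [straighten, dualIdx]

theorem lowerMat_straighten_castSucc (x : Coord n) (k : Fin (n + 1)) (j : Fin (n + 2)) :
    lowerMat (straighten x) k.castSucc j = lowerMat x k.castSucc j := by
  simp [lowerMat, straighten, (Fin.castSucc_lt_last k).ne]

theorem lowerMat_unstraighten_castSucc (y : Coord n) (k : Fin (n + 1)) (j : Fin (n + 2)) :
    lowerMat (unstraighten y) k.castSucc j = lowerMat y k.castSucc j := by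
  simp [lowerMat, unstraighten, (Fin.castSucc_lt_last k).ne]

theorem lowerMat_straighten_last (x : Coord n) {j : Fin (n + 2)} (hj : j ≠ 0) :
    lowerMat (straighten x) (Fin.last (n + 1)) j = dualRow x j := by
  cases j using Fin.lastCases with
  | last => rw [lowerMat_self, dualRow_last]
  | cast j =>
    rw [lowerMat_of_lt _ (Fin.castSucc_lt_last j)]
    exact if_pos ⟨rfl, hj⟩

theorem unstraighten_straighten (x : Coord n) : unstraighten (straighten x) = x := by
  funext ⟨⟨i, j⟩, hji⟩
  by_cases h : i = Fin.last (n + 1) ∧ j ≠ 0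
  · obtain ⟨rfl, hj⟩ := h
    obtain ⟨j, rfl⟩ := Fin.exists_castSucc_eq.2 hji.ne
    rw [unstraighten, if_pos ⟨rfl, hj⟩, ← lowerMat_of_lt x hji]
    refine ((dualRow_eq_off_zero_iff x (straighten x) fun k j =>
      (lowerMat_straighten_castSucc x k j).symm).1 (fun l hl => ?_) j hj).symm
    exact (lowerMat_straighten_last x hl).symm
  · rw [unstraighten, if_neg h, straighten, if_neg h]

theorem straighten_unstraighten (y : Coord n) : straighten (unstraighten y) = y := by
  funext ⟨⟨i, j⟩, hji⟩
  by_cases h : i = Fin.last (n + 1) ∧ j ≠ 0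
  · obtain ⟨rfl, hj⟩ := h
    rw [straighten, if_pos ⟨rfl, hj⟩, ← lowerMat_of_lt y hji]
    refine (dualRow_eq_off_zero_iff (unstraighten y) y
      (lowerMat_unstraighten_castSucc y)).2 (fun l hl => ?_) j hj
    rw [lowerMat_of_lt _ (Fin.castSucc_lt_last l)]
    exact if_pos ⟨rfl, hl⟩
  · rw [straighten, if_neg h, unstraighten, if_neg h]

theorem contDiff_lowerMat (i j : Fin (n + 2)) : ContDiff ℝ ∞ fun x : Coord n => lowerMat x i j := by
  simp only [lowerMat, Matrix.of_apply]
  split_ifs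
  · exact contDiff_apply _ _ _
  · exact contDiff_const
  · exact contDiff_const

theorem contDiff_dualRow (j : Fin (n + 2)) : ContDiff ℝ ∞ fun x : Coord n => dualRow x j := by
  simp only [dualRow, Matrix.inv_def, det_lowerMat, Ring.inverse_one, one_smul,
    Matrix.adjugate_apply]
  refine contDiff_det fun i k => ?_
  simp only [Matrix.updateRow_apply]
  split_ifs
  · exact contDiff_const
  · exact contDiff_lowerMat _ _

theorem contDiff_straighten : ContDiff ℝ ∞ (straighten (n := n)) := by
  rw [contDiff_pi]
  intro p
  simp only [straighten]
  split_ifs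
  · exact contDiff_dualRow _
  · exact contDiff_apply _ _ _

theorem contDiff_unstraighten : ContDiff ℝ ∞ (unstraighten (n := n)) := by
  rw [contDiff_pi]
  intro p
  simp only [unstraighten]
  split_ifs
  · exact (ContDiff.sum fun k _ => (contDiff_lowerMat _ _).mul (contDiff_lowerMat _ _)).neg
  · exact contDiff_apply _ _ _

end Straightening

section Lifts

variable {V : Type*} [NormedAddCommGroup V] [NormedSpace ℝ V]

/-- The sequence `γ(t), γ'(t), γ''(t), …`. -/
noncomputable def derivSeq (γ : ℝ → V) (t : ℝ) (k : ℕ) : V := iteratedDeriv k γ t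

theorem derivSeq_congr {γ₁ γ₂ : ℝ → V} {t : ℝ} (h : γ₁ =ᶠ[nhds t] γ₂) :
    derivSeq γ₁ t = derivSeq γ₂ t := funext fun k => h.iteratedDeriv_eq k

theorem osculatingSpan_derivSeq_comp_le {γ : ℝ → V} {τ : ℝ → ℝ} {t : ℝ}
    (hγ : ContDiffAt ℝ ∞ γ (τ t)) (hτ : ContDiffAt ℝ ∞ τ t) (k : ℕ) :
    osculatingSpan ℝ (derivSeq (γ ∘ τ) t) k ≤ osculatingSpan ℝ (derivSeq γ (τ t)) k := by
  rw [osculatingSpan, Submodule.span_le]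
  rintro _ ⟨i, hi, rfl⟩
  rw [derivSeq, iteratedDeriv_scomp_eq_sum_orderedFinpartition hγ hτ (by exact_mod_cast le_top)]
  exact Submodule.sum_mem _ fun c _ => Submodule.smul_mem _ _
    (apply_mem_osculatingSpan (derivSeq γ (τ t)) (c.length_le.trans hi))

theorem osculatingSpan_derivSeq_smul_le {γ : ℝ → V} {μ : ℝ → ℝ} {t : ℝ}
    (hμ : ContDiffAt ℝ ∞ μ t) (hγ : ContDiffAt ℝ ∞ γ t) (k : ℕ) :
    osculatingSpan ℝ (derivSeq (μ • γ) t) k ≤ osculatingSpan ℝ (derivSeq γ t) k := by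
  rw [osculatingSpan, Submodule.span_le]
  rintro _ ⟨i, hi, rfl⟩
  have hi' : (i : ℕ∞ω) ≤ ∞ := by exact_mod_cast le_top
  rw [derivSeq, ← iteratedDerivWithin_univ, iteratedDerivWithin_smul (Set.mem_univ t)
    uniqueDiffOn_univ (hμ.of_le hi').contDiffWithinAt (hγ.of_le hi').contDiffWithinAt]
  simp only [iteratedDerivWithin_univ]
  exact Submodule.sum_mem _ fun c _ => Submodule.smul_of_tower_mem _ _ <| Submodule.smul_mem _ _
    (apply_mem_osculatingSpan (derivSeq γ t) ((Nat.sub_le i c).trans hi))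

variable {n : ℕ}

theorem rank_derivMatrix (γ : ℝ → Vec n) (t : ℝ) (k : ℕ) :
    (derivMatrix γ t k).rank = Module.finrank ℝ (osculatingSpan ℝ (derivSeq γ t) k) := by
  have hcol : Set.range (derivMatrix γ t k).col = derivSeq γ t '' Set.Iic k := by
    rw [show (derivMatrix γ t k).col = derivSeq γ t ∘ Fin.val from rfl, Set.range_comp,
      Fin.range_val]
    exact congrArg _ (Set.ext fun i => Nat.lt_succ_iff)
  rw [Matrix.rank_eq_finrank_span_cols, osculatingSpan, hcol]

theorem eq_div_smul_of_span_eq {ι : Type*} {v w : ι → ℝ}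
    (h : Submodule.span ℝ {v} = Submodule.span ℝ {w}) {i : ι} (hi : w i ≠ 0) :
    v = (v i / w i) • w := by
  obtain ⟨c, rfl⟩ := Submodule.mem_span_singleton.1 (h ▸ Submodule.mem_span_singleton_self v)
  simp [hi]

theorem eventually_mem_source_and_mem {X Y : Type*} [TopologicalSpace X] [TopologicalSpace Y]
    {κ₁ κ₂ : OpenPartialHomeomorph X Y} {p : X} {W : Set Y}
    (hp₁ : p ∈ κ₁.source) (hp₂ : p ∈ κ₂.source) (hW : IsOpen W) (hm : κ₁ p ∈ W) :
    ∀ᶠ s in nhds (κ₂ p), κ₂.symm s ∈ κ₁.source ∧ κ₁ (κ₂.symm s) ∈ W := by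
  rw [κ₂.eventually_nhds' (fun q => q ∈ κ₁.source ∧ κ₁ q ∈ W) hp₂]
  exact (κ₁.open_source.eventually_mem hp₁).and
    ((κ₁.continuousAt hp₁).eventually (hW.eventually_mem hm))

variable {I : Type*} [TopologicalSpace I] [ChartedSpace ℝ I]

/-- In the local coordinate `κ` of `I`, on the open set `W`, the curve of lines `π_1 ∘ Γ` has the
smooth lift `γ` to `ℝ^{n+2} ∖ {0}`. -/
structure IsLift (Γ : I → CompleteFlag n) (κ : OpenPartialHomeomorph I ℝ) (γ : ℝ → Vec n)
    (W : Set ℝ) : Prop where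
  mem_atlas : κ ∈ atlas ℝ I
  isOpen : IsOpen W
  subset : W ⊆ κ.target
  smooth : ContDiffOn ℝ ∞ γ W
  line_eq : ∀ s ∈ W, γ s ≠ 0 ∧ (Γ (κ.symm s)).line = Submodule.span ℝ {γ s}

variable {Γ : I → CompleteFlag n} {κ κ₁ κ₂ : OpenPartialHomeomorph I ℝ}
  {g : GL (Fin (n + 2)) ℝ} {u : ℝ → Coord n} {γ γ₁ γ₂ : ℝ → Vec n} {W W₁ W₂ : Set ℝ} {p : I}

theorem IsLocalExpr.contDiffAt (h : IsLocalExpr Γ κ g u W) {s : ℝ} (hs : s ∈ W) :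
    ContDiffAt ℝ ∞ u s :=
  h.smooth.contDiffAt (h.isOpen.mem_nhds hs)

theorem IsLocalExpr.isLift (h : IsLocalExpr Γ κ g u W) : IsLift Γ κ (lineVec g ∘ u) W where
  mem_atlas := h.mem_atlas
  isOpen := h.isOpen
  subset := h.subset
  smooth := (contDiff_lineVec g).comp_contDiffOn h.smooth
  line_eq s hs := ⟨lineVec_ne_zero _ _, (h.expr s hs).line_eq⟩

theorem IsLocalExpr.deriv_mem_pseudoContact_iff (h : IsLocalExpr Γ κ g u W) {s : ℝ} (hs : s ∈ W) :
    deriv u s ∈ pseudoContact g (u s) ↔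
      osculatingSpan ℝ (derivSeq (lineVec g ∘ u) s) 1 ≤ (Γ (κ.symm s)).V (Fin.last n) := by
  have hu : HasDerivAt u (deriv u s) s :=
    ((h.contDiffAt hs).differentiableAt (by simp)).hasDerivAt
  have hderiv : derivSeq (lineVec g ∘ u) s 1 = fderiv ℝ (lineVec g) (u s) (deriv u s) := by
    rw [derivSeq, iteratedDeriv_one]
    have hlineVec := ((contDiff_lineVec g).differentiable (by simp) (u s)).hasFDerivAt
    exact (hlineVec.comp_hasDerivAt s hu).deriv
  have hline : derivSeq (lineVec g ∘ u) s 0 ∈ (Γ (κ.symm s)).V (Fin.last n) := by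
    refine (Γ (κ.symm s)).mono (Fin.zero_le _) ((h.expr s hs).line_eq.ge ?_)
    rw [derivSeq, iteratedDeriv_zero]
    exact Submodule.mem_span_singleton_self _
  have hforall (P : ℕ → Prop) : (∀ i ∈ Set.Iic 1, P i) ↔ P 0 ∧ P 1 := by
    simp [Nat.le_one_iff_eq_zero_or_eq_one]
  rw [osculatingSpan, Submodule.span_le, Set.image_subset_iff, Set.subset_def, hforall]
  rw [Set.mem_preimage, SetLike.mem_coe, and_iff_right hline, Set.mem_preimage, hderiv,
    h.expr s hs (Fin.last n)]
  rfl

theorem contDiffAt_transition [IsManifold 𝓘(ℝ, ℝ) ∞ I] (h₁ : κ₁ ∈ atlas ℝ I)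
    (h₂ : κ₂ ∈ atlas ℝ I) (hp₁ : p ∈ κ₁.source) (hp₂ : p ∈ κ₂.source) :
    ContDiffAt ℝ ∞ (κ₁ ∘ κ₂.symm) (κ₂ p) := by
  have h := HasGroupoid.compatible (G := contDiffGroupoid ∞ 𝓘(ℝ, ℝ)) h₂ h₁
  rw [contDiffGroupoid, mem_groupoid_of_pregroupoid] at h
  have hcont : ContDiffOn ℝ ∞ (κ₁ ∘ κ₂.symm) (κ₂.target ∩ κ₂.symm ⁻¹' κ₁.source) := by
    simpa [contDiffPregroupoid] using h.1
  refine hcont.contDiffAt ((κ₂.isOpen_inter_preimage_symm κ₁.open_source).mem_nhds ?_)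
  exact ⟨κ₂.map_source hp₂, by rwa [Set.mem_preimage, κ₂.left_inv hp₂]⟩

theorem IsLift.contDiffAt (h : IsLift Γ κ γ W) {s : ℝ} (hs : s ∈ W) : ContDiffAt ℝ ∞ γ s :=
  h.smooth.contDiffAt (h.isOpen.mem_nhds hs)

variable [IsManifold 𝓘(ℝ, ℝ) ∞ I]

/-- Near `p`, `γ₂` is the reparametrisation of `γ₁` by `κ₁ ∘ κ₂.symm` up to a smooth factor, which
can be read off from a coordinate in which `γ₁` does not vanish. -/
theorem IsLift.osculatingSpan_le (h₁ : IsLift Γ κ₁ γ₁ W₁) (h₂ : IsLift Γ κ₂ γ₂ W₂)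
    (hp₁ : p ∈ κ₁.source) (hp₂ : p ∈ κ₂.source) (hm₁ : κ₁ p ∈ W₁) (hm₂ : κ₂ p ∈ W₂) (k : ℕ) :
    osculatingSpan ℝ (derivSeq γ₂ (κ₂ p)) k ≤ osculatingSpan ℝ (derivSeq γ₁ (κ₁ p)) k := by
  obtain ⟨i, hi⟩ := Function.ne_iff.1 (h₁.line_eq _ hm₁).1
  have hτp : (κ₁ ∘ κ₂.symm) (κ₂ p) = κ₁ p := congrArg κ₁ (κ₂.left_inv hp₂)
  have hτ : ContDiffAt ℝ ∞ (κ₁ ∘ κ₂.symm) (κ₂ p) :=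
    contDiffAt_transition h₁.mem_atlas h₂.mem_atlas hp₁ hp₂
  have hγ₁ : ContDiffAt ℝ ∞ γ₁ ((κ₁ ∘ κ₂.symm) (κ₂ p)) := hτp ▸ h₁.contDiffAt hm₁
  have hcomp : ContDiffAt ℝ ∞ (γ₁ ∘ κ₁ ∘ κ₂.symm) (κ₂ p) := hγ₁.comp _ hτ
  have hcomp_i : ContDiffAt ℝ ∞ (fun s => (γ₁ ∘ κ₁ ∘ κ₂.symm) s i) (κ₂ p) :=
    contDiffAt_pi.1 hcomp i
  have hne : (γ₁ ∘ κ₁ ∘ κ₂.symm) (κ₂ p) i ≠ 0 := by rwa [Function.comp_apply, hτp]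
  have hμ : ContDiffAt ℝ ∞ (fun s => γ₂ s i / (γ₁ ∘ κ₁ ∘ κ₂.symm) s i) (κ₂ p) :=
    (contDiffAt_pi.1 (h₂.contDiffAt hm₂) i).div hcomp_i hne
  have hprop : γ₂ =ᶠ[nhds (κ₂ p)]
      (fun s => γ₂ s i / (γ₁ ∘ κ₁ ∘ κ₂.symm) s i) • (γ₁ ∘ κ₁ ∘ κ₂.symm) := by
    filter_upwards [eventually_mem_source_and_mem hp₁ hp₂ h₁.isOpen hm₁,
      h₂.isOpen.eventually_mem hm₂, hcomp_i.continuousAt.eventually_ne hne] with s hs hs₂ hsi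
    have hline₁ := (h₁.line_eq _ hs.2).2
    rw [κ₁.left_inv hs.1, (h₂.line_eq _ hs₂).2] at hline₁
    exact eq_div_smul_of_span_eq hline₁ hsi
  rw [derivSeq_congr hprop, ← hτp]
  exact (osculatingSpan_derivSeq_smul_le hμ hcomp k).trans
    (osculatingSpan_derivSeq_comp_le hγ₁ hτ k)

theorem IsLift.osculatingSpan_eq (h₁ : IsLift Γ κ₁ γ₁ W₁) (h₂ : IsLift Γ κ₂ γ₂ W₂)
    (hp₁ : p ∈ κ₁.source) (hp₂ : p ∈ κ₂.source) (hm₁ : κ₁ p ∈ W₁) (hm₂ : κ₂ p ∈ W₂) (k : ℕ) :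
    osculatingSpan ℝ (derivSeq γ₁ (κ₁ p)) k = osculatingSpan ℝ (derivSeq γ₂ (κ₂ p)) k :=
  le_antisymm (h₂.osculatingSpan_le h₁ hp₂ hp₁ hm₂ hm₁ k)
    (h₁.osculatingSpan_le h₂ hp₁ hp₂ hm₁ hm₂ k)

theorem IsLift.projIsOfType_iff (h : IsLift Γ κ γ W) (hp : p ∈ κ.source) (hm : κ p ∈ W)
    (a : Fin (n + 1) → ℕ) : ProjIsOfType Γ p a ↔ IsOfType γ (κ p) a := by
  constructor
  · rintro ⟨κ', hκ', hp', W', γ', hW', hm', hsub, hsmooth, hline, htype⟩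
    have h' : IsLift Γ κ' γ' W' := ⟨hκ', hW', hsub, hsmooth, hline⟩
    have hrank (k : ℕ) : (derivMatrix γ' (κ' p) k).rank = (derivMatrix γ (κ p) k).rank := by
      rw [rank_derivMatrix, rank_derivMatrix, h'.osculatingSpan_eq h hp' hp hm' hm]
    simpa only [IsOfType, hrank] using htype
  · intro htype
    exact ⟨κ, h.mem_atlas, hp, W, γ, h.isOpen, hm, h.subset, h.smooth, h.line_eq, htype⟩

theorem IsIntegralNear.eventually_mem_pseudoContact (hΓ : IsIntegralNear Γ p)
    (h : IsLocalExpr Γ κ g u W) (hp : p ∈ κ.source) (hm : κ p ∈ W) :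
    ∀ᶠ s in nhds (κ p), deriv u s ∈ pseudoContact g (u s) := by
  obtain ⟨κ', g', u', W', h', hp', hm', hintegral⟩ := hΓ
  filter_upwards [h.isOpen.mem_nhds hm, eventually_mem_source_and_mem hp' hp h'.isOpen hm']
    with s hs ⟨hs', hm'⟩
  have hst : s ∈ κ.target := h.subset hs
  have hspan := h'.isLift.osculatingSpan_eq h.isLift hs' (κ.map_target hst) hm'
    (by rwa [κ.right_inv hst]) 1
  rw [κ.right_inv hst] at hspan
  rw [h.deriv_mem_pseudoContact_iff hs, ← hspan]
  simpa only [κ'.left_inv hs'] using (h'.deriv_mem_pseudoContact_iff hm').1 (hintegral _ hm')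

end Lifts

section ContactEquations

theorem exists_triangular_solution {K : Type*} [Field K] {A : ℕ → ℕ → K} (hA : ∀ k, A k k ≠ 0)
    (φ : ℕ → K) : ∃ q : ℕ → K, ∀ k, ∑ i ∈ Finset.range (k + 1), A k i * q i = φ k := by
  let F (k : ℕ) (q : ∀ i < k, K) : K := (φ k - ∑ i : Fin k, A k i * q i i.2) / A k k
  refine ⟨Nat.lt_wfRel.wf.fix F, fun k => ?_⟩
  rw [Finset.sum_range_succ, WellFounded.fix_eq, mul_div_cancel₀ _ (hA k),
    Finset.sum_range (n := k)]
  exact add_sub_cancel _ _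

variable {n r : ℕ}

/-- The derivative of order `k` of `∑ y_j x_j'` in terms of the derivatives `y i`, `x i` of order
`i` of the factors. -/
def leibnizPairing (y x : ℕ → Fin n → ℝ) (k : ℕ) : ℝ :=
  ∑ i ∈ Finset.range (k + 1), (k.choose i : ℝ) * (y i ⬝ᵥ x (k - i + 1))

theorem leibnizPairing_congr {y y' x x' : ℕ → Fin n → ℝ} {k : ℕ} (hy : ∀ i ≤ k, y i = y' i)
    (hx : ∀ i, 1 ≤ i → i ≤ k + 1 → x i = x' i) :
    leibnizPairing y x k = leibnizPairing y' x' k := by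
  refine Finset.sum_congr rfl fun i hi => ?_
  rw [hy i (Nat.lt_succ_iff.1 (Finset.mem_range.1 hi)), hx (k - i + 1) (by omega) (by omega)]

@[simp]
theorem leibnizPairing_zero_left (x : ℕ → Fin n → ℝ) (k : ℕ) : leibnizPairing 0 x k = 0 := by
  simp [leibnizPairing]

theorem leibnizPairing_single_left (d : ℕ) (y : Fin n → ℝ) (x : ℕ → Fin n → ℝ) (k : ℕ) :
    leibnizPairing (Pi.single d y) x k = (k.choose d : ℝ) * (y ⬝ᵥ x (k - d + 1)) := by
  rw [leibnizPairing, Finset.sum_eq_single d, Pi.single_eq_same]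
  · intro i _ hi
    rw [Pi.single_eq_of_ne hi, zero_dotProduct, mul_zero]
  · intro hd
    rw [Nat.choose_eq_zero_of_lt (by simpa using hd), Nat.cast_zero, zero_mul]

@[simp]
theorem leibnizPairing_zero_right (y : ℕ → Fin n → ℝ) (k : ℕ) : leibnizPairing y 0 k = 0 := by
  simp [leibnizPairing]

theorem leibnizPairing_eq_zero (y : ℕ → Fin n → ℝ) {x : ℕ → Fin n → ℝ} {k : ℕ}
    (hx : ∀ i, 1 ≤ i → i ≤ k + 1 → x i = 0) : leibnizPairing y x k = 0 :=
  (leibnizPairing_congr (fun _ _ => rfl) hx).trans (leibnizPairing_zero_right y k)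

theorem leibnizPairing_add_smul (y y' x x' : ℕ → Fin n → ℝ) (s : ℝ) (k : ℕ) :
    leibnizPairing (y + s • y') (x + s • x') k = leibnizPairing y x k +
      s * (leibnizPairing y x' k + leibnizPairing y' x k) + s ^ 2 * leibnizPairing y' x' k := by
  simp only [leibnizPairing, Finset.mul_sum, ← Finset.sum_add_distrib]
  refine Finset.sum_congr rfl fun i _ => ?_
  simp only [Pi.add_apply, Pi.smul_apply, add_dotProduct, dotProduct_add, smul_dotProduct,
    dotProduct_smul, smul_eq_mul]
  ring

theorem exists_leibnizPairing_eq {x : ℕ → Fin n → ℝ} {m : ℕ} (hm : 1 ≤ m)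
    (hlt : ∀ c, 1 ≤ c → c < m → x c = 0) (hne : x m ≠ 0) (φ : ℕ → ℝ) :
    ∃ y : ℕ → Fin n → ℝ, ∀ k, m ≤ k + 1 → leibnizPairing y x k = φ k := by
  let A (l i : ℕ) : ℝ := ((m - 1 + l).choose i : ℝ) * (x m ⬝ᵥ x (m - 1 + l - i + 1))
  have hdiag (l : ℕ) : A l l ≠ 0 := by
    refine mul_ne_zero (Nat.cast_ne_zero.2 (Nat.choose_pos (by omega)).ne') ?_
    rw [Nat.add_sub_cancel, Nat.sub_add_cancel hm]
    exact mt dotProduct_self_eq_zero.1 hne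
  obtain ⟨q, hq⟩ := exists_triangular_solution hdiag fun l => φ (m - 1 + l)
  refine ⟨fun i => q i • x m, fun k hk => ?_⟩
  obtain ⟨l, rfl⟩ : ∃ l, k = m - 1 + l := ⟨k - (m - 1), by omega⟩
  rw [← hq l, leibnizPairing]
  refine (Finset.sum_subset (Finset.range_mono (by omega)) fun i hi hil => ?_).symm.trans
    (Finset.sum_congr rfl fun i _ => ?_)
  · rw [Finset.mem_range] at hi hil
    rw [hlt (m - 1 + l - i + 1) (by omega) (by omega), dotProduct_zero, mul_zero]
  · rw [smul_dotProduct, smul_eq_mul]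
    ring

/-- The coordinates `x_1, …, x_n` in which, together with `yPart` and `zPart`, the equation of the
straightened pseudo-contact distribution is `dz + ∑ y_j dx_j = 0`. -/
def xPart : Coord n →L[ℝ] (Fin n → ℝ) :=
  ContinuousLinearMap.pi fun j => ContinuousLinearMap.proj (lineIdx j.castSucc)

/-- The coordinates `y_1, …, y_n`, see `xPart`. -/
def yPart : Coord n →L[ℝ] (Fin n → ℝ) :=
  ContinuousLinearMap.pi fun j => ContinuousLinearMap.proj (dualIdx j)

/-- The coordinate `z`, see `xPart`. -/
def zPart : Coord n →L[ℝ] ℝ :=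
  ContinuousLinearMap.proj (lineIdx (Fin.last n))

theorem mem_pseudoContact_iff_straighten (g : GL (Fin (n + 2)) ℝ) (x v : Coord n) :
    v ∈ pseudoContact g x ↔ zPart v + yPart (straighten x) ⬝ᵥ xPart v = 0 := by
  rw [mem_pseudoContact_iff]
  simp [zPart, yPart, xPart, dotProduct, straighten_dualIdx]

theorem exists_coord (X Y : Fin n → ℝ) (z : ℝ) :
    ∃ y : Coord n, xPart y = X ∧ yPart y = Y ∧ zPart y = z := by
  have hinj : Function.Injective (Sum.elim (lineIdx (n := n)) dualIdx) :=
    lineIdx_injective.sumElim dualIdx_injective lineIdx_ne_dualIdx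
  let y : Coord n := Function.extend (Sum.elim lineIdx dualIdx)
    (Sum.elim (Fin.snoc (α := fun _ => ℝ) X z) Y) 0
  have hline (i : Fin (n + 1)) : y (lineIdx i) = Fin.snoc (α := fun _ => ℝ) X z i :=
    hinj.extend_apply _ _ (Sum.inl i)
  have hdual (j : Fin n) : y (dualIdx j) = Y j := hinj.extend_apply _ _ (Sum.inr j)
  refine ⟨y, funext fun j => ?_, funext hdual, ?_⟩
  · exact (hline j.castSucc).trans (Fin.snoc_castSucc (α := fun _ => ℝ) z X j)
  · exact (hline (Fin.last n)).trans (Fin.snoc_last (α := fun _ => ℝ) z X)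

/-- The derivatives of the coordinates `x` recorded in a jet. -/
noncomputable def xJet : (Fin (r + 1) → Coord n) →L[ℝ] (ℕ → Fin n → ℝ) :=
  ContinuousLinearMap.pi fun k => xPart.comp (jetAt k)

/-- The derivatives of the coordinates `y` recorded in a jet. -/
noncomputable def yJet : (Fin (r + 1) → Coord n) →L[ℝ] (ℕ → Fin n → ℝ) :=
  ContinuousLinearMap.pi fun k => yPart.comp (jetAt k)

/-- The derivatives of the coordinate `z` recorded in a jet. -/
noncomputable def zJet : (Fin (r + 1) → Coord n) →L[ℝ] (ℕ → ℝ) :=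
  ContinuousLinearMap.pi fun k => zPart.comp (jetAt k)

theorem exists_jet (r : ℕ) (X Y : ℕ → Fin n → ℝ) (Z : ℕ → ℝ) :
    ∃ w : Fin (r + 1) → Coord n, ∀ k ≤ r, xJet w k = X k ∧ yJet w k = Y k ∧ zJet w k = Z k := by
  choose w hw using fun k : ℕ => exists_coord (X k) (Y k) (Z k)
  refine ⟨fun k => w k, fun k hk => ?_⟩
  simpa [xJet, yJet, zJet, jetAt_of_le hk] using hw k

/-- The derivative of order `k` of the contact form along a curve, as a function of its jet. -/
noncomputable def contactEq (w : Fin (r + 1) → Coord n) (k : ℕ) : ℝ :=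
  zJet w (k + 1) + leibnizPairing (yJet w) (xJet w) k

/-- The differential of `contactEq` in the direction `δ`. -/
noncomputable def contactLin (w δ : Fin (r + 1) → Coord n) (k : ℕ) : ℝ :=
  zJet δ (k + 1) + (leibnizPairing (yJet w) (xJet δ) k + leibnizPairing (yJet δ) (xJet w) k)

theorem contDiff_contactEq (k : ℕ) :
    ContDiff ℝ ∞ fun w : Fin (r + 1) → Coord n => contactEq w k := by
  have hx (i : ℕ) : ContDiff ℝ ∞ fun w : Fin (r + 1) → Coord n => xJet w i :=
    (xPart.comp (jetAt i)).contDiff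
  have hy (i : ℕ) : ContDiff ℝ ∞ fun w : Fin (r + 1) → Coord n => yJet w i :=
    (yPart.comp (jetAt i)).contDiff
  refine (zPart.comp (jetAt (k + 1))).contDiff.add (ContDiff.sum fun i _ => ?_)
  exact contDiff_const.mul
    (ContDiff.sum fun j _ => (contDiff_pi.1 (hy _) j).mul (contDiff_pi.1 (hx _) j))

theorem hasDerivAt_contactEq (w δ : Fin (r + 1) → Coord n) (k : ℕ) :
    HasDerivAt (fun s : ℝ => contactEq (w + s • δ) k) (contactLin w δ k) 0 := by
  have hquad (s : ℝ) : contactEq (w + s • δ) k =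
      contactEq w k + s * contactLin w δ k + s ^ 2 * leibnizPairing (yJet δ) (xJet δ) k := by
    simp only [contactEq, contactLin, map_add, map_smul, leibnizPairing_add_smul, Pi.add_apply,
      Pi.smul_apply, smul_eq_mul]
    ring
  simp only [hquad]
  simpa using (((hasDerivAt_id (0 : ℝ)).mul_const (contactLin w δ k)).const_add
    (contactEq w k)).fun_add (((hasDerivAt_id (0 : ℝ)).fun_pow 2).mul_const
      (leibnizPairing (yJet δ) (xJet δ) k))

theorem contactLin_eq {w δ : Fin (r + 1) → Coord n} {X Y : ℕ → Fin n → ℝ} {Z : ℕ → ℝ}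
    (hδ : ∀ k ≤ r, xJet δ k = X k ∧ yJet δ k = Y k ∧ zJet δ k = Z k) {k : ℕ} (hk : k < r) :
    contactLin w δ k =
      Z (k + 1) + (leibnizPairing (yJet w) X k + leibnizPairing Y (xJet w) k) := by
  rw [contactLin, (hδ (k + 1) hk).2.2,
    leibnizPairing_congr (fun _ _ => rfl) fun i _ hi => (hδ i (by omega)).1,
    leibnizPairing_congr (fun i hi => (hδ i (by omega)).2.1) fun _ _ _ => rfl]

/-- The jet coordinates with parameter in `T` that satisfy the contact equations. -/
def contactSet (n r : ℕ) (T : Set ℝ) : Set (JetCoord n r) :=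
  {p | p.1 ∈ T ∧ ∀ k < r, contactEq p.2 k = 0}

theorem isSubmanifoldOfCodim_contactSet {T : Set ℝ} (hT : IsOpen T) :
    IsSubmanifoldOfCodim (contactSet n r T) r := by
  have hcard : IsSubmanifoldOfCodim (contactSet n r T) (Fintype.card (Fin r)) := by
    refine isSubmanifoldOfCodim_of_equations fun p hp => ?_
    have hsmooth : ContDiff ℝ ∞ fun (q : JetCoord n r) (k : Fin r) => contactEq q.2 k :=
      contDiff_pi.2 fun k => (contDiff_contactEq _).comp contDiff_snd
    refine ⟨{q | q.1 ∈ T}, _, hT.preimage continuous_fst, hp.1, hsmooth, ?_, ?_⟩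
    · refine surjective_fderiv_of_hasDerivAt_line (hsmooth.differentiable (by simp) p) fun η => ?_
      obtain ⟨δ, hδ⟩ := exists_jet (n := n) r 0 0
        fun k => if h : k - 1 < r then η ⟨k - 1, h⟩ else 0
      refine ⟨(0, δ), hasDerivAt_pi.2 fun k => ?_⟩
      simpa [contactLin_eq hδ k.2] using hasDerivAt_contactEq p.2 δ k
    · ext q
      simp [contactSet, funext_iff, Fin.forall_iff, and_comm]
  rwa [Fintype.card_fin] at hcard

/-- The equations of index `≥ m - 1` are solved for the `y`-derivatives, whose pairing with the
`x`-derivative of order `m` is the leading term; those of smaller index for the `z`-derivatives. -/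
theorem exists_contactLin_eq {w : Fin (r + 1) → Coord n} {m : ℕ} (hm : 1 ≤ m)
    (hlt : ∀ c, 1 ≤ c → c < m → xJet w c = 0) (hne : xJet w m ≠ 0) (X : ℕ → Fin n → ℝ)
    (Z ζ : ℕ → ℝ) :
    ∃ δ : Fin (r + 1) → Coord n, (∀ k ≤ r, xJet δ k = X k) ∧
      (∀ k ≤ r, k = 0 ∨ m ≤ k → zJet δ k = Z k) ∧ ∀ k < r, contactLin w δ k = ζ k := by
  let Z' (k : ℕ) : ℝ :=
    if k = 0 ∨ m ≤ k then Z k else ζ (k - 1) - leibnizPairing (yJet w) X (k - 1)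
  obtain ⟨Y, hY⟩ := exists_leibnizPairing_eq hm hlt hne
    fun k => ζ k - Z (k + 1) - leibnizPairing (yJet w) X k
  obtain ⟨δ, hδ⟩ := exists_jet r X Y Z'
  refine ⟨δ, fun k hk => (hδ k hk).1, fun k hk h => (hδ k hk).2.2.trans (if_pos h),
    fun k hk => ?_⟩
  rw [contactLin_eq hδ hk]
  by_cases hmk : m ≤ k + 1
  · simp only [Z', if_pos (Or.inr hmk), hY k hmk]
    ring
  · have hlow : leibnizPairing Y (xJet w) k = 0 :=
      leibnizPairing_eq_zero Y fun i hi hik => hlt i hi (by omega)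
    simp [Z', hmk, hlow]

end ContactEquations

section Types

variable {n r : ℕ} {a : Fin (n + 1) → ℕ}

/-- The orders `0 < a_1 < ⋯ < a_{n+1}` of the derivatives that form a basis at a point of
type `a`. -/
def orders (a : Fin (n + 1) → ℕ) : Fin (n + 2) → ℕ := Fin.cons 0 a

@[simp]
theorem orders_zero (a : Fin (n + 1) → ℕ) : orders a 0 = 0 := rfl

@[simp]
theorem orders_succ (a : Fin (n + 1) → ℕ) (i : Fin (n + 1)) : orders a i.succ = a i := rfl

theorem strictMono_orders (ha : StrictMono a) (ha₁ : 1 ≤ a 0) : StrictMono (orders a) := by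
  rw [Fin.strictMono_iff_lt_succ]
  intro i
  cases i using Fin.cases with
  | zero => exact ha₁
  | succ i => exact ha (Fin.castSucc_lt_succ (i := i))

theorem orders_le (ha : StrictMono a) (hr : a (Fin.last n) ≤ r) (i : Fin (n + 2)) :
    orders a i ≤ r := by
  cases i using Fin.cases with
  | zero => exact Nat.zero_le r
  | succ i => exact (ha.monotone (Fin.le_last i)).trans hr

theorem isOfType_iff_isAdapted (ha : StrictMono a) (ha₁ : 1 ≤ a 0) {γ : ℝ → Vec n} {t : ℝ}
    (h : γ t ≠ 0) : IsOfType γ t a ↔ IsAdapted ℝ (derivSeq γ t) (orders a) := by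
  have hzero : Module.finrank ℝ (osculatingSpan ℝ (derivSeq γ t) 0) = 1 := by
    have hIic : Set.Iic 0 = {0} := Set.Iic_bot
    rw [osculatingSpan, hIic, Set.image_singleton, derivSeq, iteratedDeriv_zero,
      finrank_span_singleton h]
  rw [isAdapted_iff_isLeast_finrank (strictMono_orders ha ha₁), Fin.forall_fin_succ,
    and_iff_right ⟨hzero, fun k _ => Nat.zero_le k⟩]
  simp only [IsOfType, rank_derivMatrix, orders_succ, Fin.val_succ]

/-- The derivatives, recorded in a jet, of the homogeneous coordinates `homogVec 1` of the
line `V_1`. -/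
noncomputable def lineJet (w : Fin (r + 1) → Coord n) (c : ℕ) : Vec n :=
  homogVec (if c = 0 then 1 else 0) (jetAt c w)

theorem homogVec_eq_iff {c : ℝ} {x : Coord n} {v : Vec n} :
    homogVec c x = v ↔
      c = v 0 ∧ (∀ j : Fin n, xPart x j = v j.castSucc.succ) ∧ zPart x = v (Fin.last (n + 1)) := by
  rw [funext_iff, Fin.forall_fin_succ, Fin.forall_fin_succ', Fin.succ_last, ← Fin.succ_last]
  rfl

theorem lineJet_eq_zero_iff {w : Fin (r + 1) → Coord n} {c : ℕ} (hc : 1 ≤ c) :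
    lineJet w c = 0 ↔ xJet w c = 0 ∧ zJet w c = 0 := by
  rw [lineJet, if_neg (Nat.one_le_iff_ne_zero.1 hc), homogVec_eq_iff, funext_iff]
  exact and_iff_right rfl

theorem iteratedDeriv_homogVec {u : ℝ → Coord n} {s : ℝ} (hu : ContDiffAt ℝ ∞ u s) (k : ℕ) :
    iteratedDeriv k (fun t => homogVec 1 (u t)) s =
      homogVec (if k = 0 then 1 else 0) (iteratedDeriv k u s) := by
  have hk : ContDiffAt ℝ k u s := hu.of_le (by exact_mod_cast le_top)
  have hγ : ContDiffAt ℝ k (fun t => homogVec 1 (u t)) s :=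
    (contDiff_homogVec 1 contDiff_id).contDiffAt.comp s hu |>.of_le (by exact_mod_cast le_top)
  funext i
  refine (iteratedDeriv_clm_comp (ContinuousLinearMap.proj (R := ℝ) i) hγ).symm.trans ?_
  cases i using Fin.cases with
  | zero => exact iteratedDeriv_const
  | succ i => exact iteratedDeriv_clm_comp (ContinuousLinearMap.proj (R := ℝ) (lineIdx i)) hk

theorem isOfType_lineVec_iff (g : GL (Fin (n + 2)) ℝ) (ha : StrictMono a) (ha₁ : 1 ≤ a 0)
    (hr : a (Fin.last n) ≤ r) {u : ℝ → Coord n} {s : ℝ} (hu : ContDiffAt ℝ ∞ u s) :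
    IsOfType (lineVec g ∘ u) s a ↔ IsAdapted ℝ (lineJet (curveJet r u s)) (orders a) := by
  let L := Matrix.mulVecLin (g : Mat n)
  have hderiv (k : ℕ) (hk : k ≤ r) :
      derivSeq (lineVec g ∘ u) s k = (L ∘ lineJet (curveJet r u s)) k := by
    have hγ : ContDiffAt ℝ k (fun t => homogVec 1 (u t)) s :=
      (contDiff_homogVec 1 contDiff_id).contDiffAt.comp s hu |>.of_le (by exact_mod_cast le_top)
    rw [derivSeq, funext (lineVec_eq_mulVec g)]
    refine (iteratedDeriv_clm_comp L.toContinuousLinearMap hγ).trans ?_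
    rw [iteratedDeriv_homogVec hu, Function.comp_apply, lineJet, jetAt_curveJet hk]
    rfl
  rw [isOfType_iff_isAdapted ha ha₁ (lineVec_ne_zero g (u s)),
    ← isAdapted_comp_iff (L := L) (v := lineJet _)
      (Matrix.mulVec_injective_iff_isUnit.2 g.isUnit)]
  exact ⟨IsAdapted.congr (orders_le ha hr) hderiv,
    IsAdapted.congr (orders_le ha hr) fun k hk => (hderiv k hk).symm⟩

end Types

section TypeEquations

variable {n r : ℕ} {a : Fin (n + 1) → ℕ} {w : Fin (r + 1) → Coord n}

theorem lineJet_eq_zero_of_isAdapted (h : IsAdapted ℝ (lineJet w) (orders a)) {c : ℕ} (hc : 1 ≤ c)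
    (hca : c < a 0) : lineJet w c = 0 := by
  have hIio : Set.Iio (1 : Fin (n + 2)) = {0} := by
    ext i
    simp [Fin.lt_one_iff]
  have hmem := h.2 1 c hca
  rw [hIio, Set.image_singleton, Submodule.mem_span_singleton] at hmem
  obtain ⟨t, ht⟩ := hmem
  have ht0 : t = 0 := by
    simpa [lineJet, homogVec_zero, Nat.one_le_iff_ne_zero.1 hc] using congrFun ht 0
  rw [← ht, ht0, zero_smul]

theorem zJet_eq_zero_of_contactEq {c : ℕ} (hc : 1 ≤ c) (hw : contactEq w (c - 1) = 0)
    (hx : ∀ i, 1 ≤ i → i ≤ c → xJet w i = 0) : zJet w c = 0 := by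
  obtain ⟨k, rfl⟩ := Nat.exists_eq_add_of_le' hc
  rwa [contactEq, Nat.add_sub_cancel, leibnizPairing_eq_zero (yJet w) hx, add_zero] at hw

theorem xJet_ne_zero_of_isAdapted (ha₁ : 1 ≤ a 0) (hr : a 0 ≤ r)
    (hw : ∀ k < r, contactEq w k = 0) (h : IsAdapted ℝ (lineJet w) (orders a)) :
    xJet w (a 0) ≠ 0 := by
  intro h0
  have hx (i : ℕ) (hi : 1 ≤ i) (hia : i ≤ a 0) : xJet w i = 0 := by
    obtain rfl | hia := hia.eq_or_lt
    · exact h0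
    · exact ((lineJet_eq_zero_iff hi).1 (lineJet_eq_zero_of_isAdapted h hi hia)).1
  have hz := zJet_eq_zero_of_contactEq ha₁ (hw (a 0 - 1) (by omega)) hx
  exact h.1.ne_zero 1 ((lineJet_eq_zero_iff ha₁).2 ⟨h0, hz⟩)

/-- The positive integers below `a i` that are not among the `a l`. -/
def gaps (a : Fin (n + 1) → ℕ) (i : Fin (n + 1)) : Finset ℕ :=
  Finset.Ico 1 (a i) \ Finset.univ.image a

theorem mem_gaps {i : Fin (n + 1)} {c : ℕ} :
    c ∈ gaps a i ↔ (1 ≤ c ∧ c < a i) ∧ ∀ l, a l ≠ c := by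
  simp [gaps]

theorem card_gaps (ha : StrictMono a) (ha₁ : 1 ≤ a 0) (i : Fin (n + 1)) :
    ((gaps a i).card : ℤ) = a i - ((i : ℕ) + 1) := by
  have hpos (l : Fin (n + 1)) : 1 ≤ a l := ha₁.trans (ha.monotone (Fin.zero_le l))
  have hsub : (Finset.Iio i).image a ⊆ Finset.Ico 1 (a i) := fun c hc => by
    obtain ⟨l, hl, rfl⟩ := Finset.mem_image.1 hc
    exact Finset.mem_Ico.2 ⟨hpos l, ha (Finset.mem_Iio.1 hl)⟩
  have hgaps : gaps a i = Finset.Ico 1 (a i) \ (Finset.Iio i).image a := by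
    ext c
    simp only [mem_gaps, Finset.mem_sdiff, Finset.mem_Ico, Finset.mem_image, Finset.mem_Iio,
      not_exists, not_and]
    refine and_congr_right fun hc => ⟨fun h l _ => h l, fun h l hl => h l ?_ hl⟩
    exact ha.lt_iff_lt.1 (hl.trans_lt hc.2)
  have hcard := Finset.card_le_card hsub
  rw [hgaps, Finset.card_sdiff_of_subset hsub, Nat.cast_sub hcard,
    Finset.card_image_of_injective _ ha.injective, Nat.card_Ico, Fin.card_Iio,
    Nat.cast_sub (hpos i)]
  push_cast
  ring

/-- The index set of the equations that single out type `a` among the jets satisfying the contact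
equations. -/
abbrev TypeEqIdx (a : Fin (n + 1) → ℕ) : Type := Σ j : Fin n, gaps a j.succ

theorem card_typeEqIdx (ha : StrictMono a) (ha₁ : 1 ≤ a 0) :
    (Fintype.card (TypeEqIdx a) : ℤ) = ∑ j : Fin n, ((a j.succ : ℤ) - ((j : ℕ) + 2)) := by
  simp only [Fintype.card_sigma, Fintype.card_coe, Nat.cast_sum, card_gaps ha ha₁]
  refine Finset.sum_congr rfl fun j _ => ?_
  push_cast [Fin.val_succ]
  ring

/-- The equations for type `a` on the open set where the derivatives of orders `orders a` are
linearly independent. In orders below `a 0` the whole derivative has to vanish, including its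
component along the derivative of order `a 0`, so all its `x`-coordinates are used; its
`z`-coordinate then vanishes by the contact equations. -/
noncomputable def typeEq (a : Fin (n + 1) → ℕ) (w : Fin (r + 1) → Coord n) (q : TypeEqIdx a) : ℝ :=
  if (q.2 : ℕ) < a 0 then xJet w q.2 q.1
  else (frameMatrix (lineJet w) (orders a)).cramer (lineJet w q.2) q.1.succ.succ

theorem isAdapted_lineJet_iff (ha : StrictMono a) (ha₁ : 1 ≤ a 0) (hr : a 0 ≤ r)
    (hw : ∀ k < r, contactEq w k = 0)
    (hdet : IsUnit (frameMatrix (lineJet w) (orders a)).det) :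
    IsAdapted ℝ (lineJet w) (orders a) ↔ ∀ q, typeEq a w q = 0 := by
  have hcramer := isAdapted_iff_cramer (strictMono_orders ha ha₁).monotone hdet
  constructor
  · rintro h ⟨j, c, hc⟩
    obtain ⟨⟨hc1, hcj⟩, -⟩ := mem_gaps.1 hc
    unfold typeEq
    split_ifs with hca
    · have hx := (lineJet_eq_zero_iff hc1).1 (lineJet_eq_zero_of_isAdapted h hc1 hca)
      exact congrFun hx.1 j
    · exact hcramer.1 h j.succ.succ c hcj
  · intro h
    have hx (c : ℕ) (hc : 1 ≤ c) (hca : c < a 0) : xJet w c = 0 := by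
      have hlt (i : Fin (n + 1)) : c < a i := hca.trans_le (ha.monotone (Fin.zero_le i))
      funext j
      simpa [typeEq, hca] using h ⟨j, c, mem_gaps.2 ⟨⟨hc, hlt _⟩, fun l => (hlt l).ne'⟩⟩
    have hline (c : ℕ) (hc : 1 ≤ c) (hca : c < a 0) : lineJet w c = 0 :=
      (lineJet_eq_zero_iff hc).2 ⟨hx c hc hca, zJet_eq_zero_of_contactEq hc (hw _ (by omega))
        fun i hi hic => hx i hi (by omega)⟩
    refine hcramer.2 fun i c hc => ?_
    by_cases hrange : ∃ l, orders a l = c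
    · obtain ⟨l, rfl⟩ := hrange
      have hil : i ≠ l := by
        rintro rfl
        exact lt_irrefl _ hc
      rw [cramer_frameMatrix_apply, Pi.single_eq_of_ne hil]
    · push Not at hrange
      have hc1 : 1 ≤ c := Nat.one_le_iff_ne_zero.2 (hrange 0).symm
      obtain hca | hca := lt_or_ge c (a 0)
      · rw [hline c hc1 hca, map_zero, Pi.zero_apply]
      · cases i using Fin.cases with
        | zero => exact absurd hc (Nat.not_lt_zero c)
        | succ i =>
          cases i using Fin.cases with
          | zero => exact absurd hc hca.not_gt
          | succ j =>
            simpa [typeEq, hca.not_gt] using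
              h ⟨j, c, mem_gaps.2 ⟨⟨hc1, hc⟩, fun l => hrange l.succ⟩⟩

theorem contDiff_lineJet (c : ℕ) : ContDiff ℝ ∞ fun w : Fin (r + 1) → Coord n => lineJet w c :=
  contDiff_homogVec _ (jetAt (V := Coord n) c).contDiff

theorem contDiff_frameMatrix_lineJet (a : Fin (n + 1) → ℕ) (i j : Fin (n + 2)) :
    ContDiff ℝ ∞ fun w : Fin (r + 1) → Coord n => frameMatrix (lineJet w) (orders a) i j :=
  contDiff_pi.1 (contDiff_lineJet (orders a j)) i

theorem contDiff_typeEq (a : Fin (n + 1) → ℕ) (q : TypeEqIdx a) :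
    ContDiff ℝ ∞ fun w : Fin (r + 1) → Coord n => typeEq a w q := by
  unfold typeEq
  split_ifs
  · exact contDiff_pi.1 (xPart.comp (jetAt (q.2 : ℕ))).contDiff q.1
  · exact contDiff_cramer (contDiff_frameMatrix_lineJet a) (contDiff_lineJet _) _

theorem lineJet_add_smul {δ : Fin (r + 1) → Coord n} {c : ℕ} {D : Vec n} (h0 : D 0 = 0)
    (hx : ∀ j : Fin n, xJet δ c j = D j.castSucc.succ) (hz : zJet δ c = D (Fin.last (n + 1)))
    (s : ℝ) : lineJet (w + s • δ) c = lineJet w c + s • D := by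
  have hD : homogVec 0 (jetAt c δ) = D := homogVec_eq_iff.2 ⟨h0.symm, hx, hz⟩
  rw [← hD, lineJet, lineJet, ← homogVec_add_smul, mul_zero, add_zero, map_add, map_smul]

theorem exists_variation (ha : StrictMono a) (ha₁ : 1 ≤ a 0)
    (hdet : IsUnit (frameMatrix (lineJet w) (orders a)).det) (η : Fin n → ℕ → ℝ)
    (hη : ∀ j i, η j (orders a i) = 0) :
    ∃ D : ℕ → Vec n, (∀ c, D c 0 = 0) ∧ (∀ i, D (orders a i) = 0) ∧
      ∀ c j, (frameMatrix (lineJet w) (orders a)).cramer (D c) j.succ.succ = η j c := by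
  set A := frameMatrix (lineJet w) (orders a) with hA
  let e (c : ℕ) : Vec n := Fin.cons 0 (Fin.cons 0 fun j => η j c)
  have he (i : Fin (n + 2)) : e (orders a i) = 0 := by
    funext j
    cases j using Fin.cases with
    | zero => rfl
    | succ j =>
      cases j using Fin.cases with
      | zero => rfl
      | succ j => exact hη j i
  have hrow : A 0 = Pi.single 0 1 := by
    funext j
    have hj : orders a j = 0 ↔ j = 0 := (strictMono_orders ha ha₁).injective.eq_iff' (orders_zero a)
    simp [hA, frameMatrix, lineJet, homogVec_zero, Pi.single_apply, hj]
  refine ⟨fun c => A.det⁻¹ • A.mulVec (e c), fun c => ?_, fun i => ?_, fun c j => ?_⟩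
  · simp [Matrix.mulVec, hrow, e]
  · beta_reduce
    rw [he, Matrix.mulVec_zero, smul_zero]
  · rw [map_smul, Matrix.cramer_eq_adjugate_mulVec, Matrix.mulVec_mulVec, Matrix.adjugate_mul,
      Matrix.smul_mulVec, Matrix.one_mulVec, smul_smul, inv_mul_cancel₀ hdet.ne_zero, one_smul]
    rfl

/-- The extension by zero of a family indexed by `TypeEqIdx a` to all orders. -/
noncomputable def extendGaps (η : TypeEqIdx a → ℝ) (j : Fin n) (c : ℕ) : ℝ :=
  if hc : c ∈ gaps a j.succ then η ⟨j, c, hc⟩ else 0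

theorem extendGaps_orders (η : TypeEqIdx a → ℝ) (j : Fin n) (i : Fin (n + 2)) :
    extendGaps η j (orders a i) = 0 := by
  refine dif_neg fun hi => ?_
  cases i using Fin.cases with
  | zero => exact absurd (mem_gaps.1 hi).1.1 (by simp)
  | succ i => exact (mem_gaps.1 hi).2 i rfl

theorem exists_contactLin_eq_and_typeEq_eq (ha : StrictMono a) (ha₁ : 1 ≤ a 0)
    (hr : a (Fin.last n) ≤ r) (hw : ∀ k < r, contactEq w k = 0)
    (h : IsAdapted ℝ (lineJet w) (orders a)) (ζ : ℕ → ℝ) (η : TypeEqIdx a → ℝ) :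
    ∃ δ : Fin (r + 1) → Coord n, (∀ k < r, contactLin w δ k = ζ k) ∧
      ∀ q (s : ℝ), typeEq a (w + s • δ) q = typeEq a w q + s * η q := by
  have hmono : ∀ i, a 0 ≤ a i := fun i => ha.monotone (Fin.zero_le i)
  obtain ⟨D, hD0, hDa, hD⟩ := exists_variation ha ha₁ h.isUnit_det_frameMatrix _
    (extendGaps_orders η)
  have hlt (c : ℕ) (hc : 1 ≤ c) (hca : c < a 0) : xJet w c = 0 :=
    ((lineJet_eq_zero_iff hc).1 (lineJet_eq_zero_of_isAdapted h hc hca)).1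
  obtain ⟨δ, hX, hZ, hζ⟩ := exists_contactLin_eq ha₁ hlt
    (xJet_ne_zero_of_isAdapted ha₁ ((hmono _).trans hr) hw h)
    (fun c j => if c < a 0 then extendGaps η j c else D c j.castSucc.succ)
    (fun c => D c (Fin.last _)) ζ
  have hline (c : ℕ) (hc : c ≤ r) (hca : a 0 ≤ c) (s : ℝ) :
      lineJet (w + s • δ) c = lineJet w c + s • D c :=
    lineJet_add_smul (hD0 c) (fun j => by simp [hX c hc, hca.not_gt])
      (hZ c hc (Or.inr hca)) s
  have hline0 (s : ℝ) : lineJet (w + s • δ) 0 = lineJet w 0 + s • D 0 := by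
    refine lineJet_add_smul (hD0 0) (fun j => ?_) (hZ 0 (Nat.zero_le r) (Or.inl rfl)) s
    have hD0 : D 0 = 0 := hDa 0
    rw [hX 0 (Nat.zero_le r), hD0]
    exact (if_pos ha₁).trans (extendGaps_orders η j 0)
  have hframe (s : ℝ) : frameMatrix (lineJet (w + s • δ)) (orders a) =
      frameMatrix (lineJet w) (orders a) := by
    refine congrArg (fun v => (Matrix.of v).transpose) (funext fun i => ?_)
    have hi : lineJet (w + s • δ) (orders a i) = lineJet w (orders a i) + s • D (orders a i) := by
      cases i using Fin.cases with
      | zero => exact hline0 s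
      | succ i => exact hline (a i) (orders_le ha hr i.succ) (hmono i) s
    rw [Function.comp_apply, hi, hDa, smul_zero, add_zero, Function.comp_apply]
  refine ⟨δ, hζ, ?_⟩
  rintro ⟨j, c, hc⟩ s
  have hcr : c ≤ r := (mem_gaps.1 hc).1.2.le.trans (orders_le ha hr j.succ.succ)
  have hηc : extendGaps η j c = η ⟨j, c, hc⟩ := dif_pos hc
  simp only [typeEq, hframe]
  split_ifs with hca
  · rw [map_add, map_smul, Pi.add_apply, Pi.smul_apply, hX c hcr]
    simp [hca, hηc]
  · rw [hline c hcr (not_lt.1 hca), map_add, map_smul, Pi.add_apply, Pi.smul_apply, hD, hηc,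
      smul_eq_mul]

/-- The part of `contactSet` where the type is `a`. -/
def contactTypeSet (n r : ℕ) (T : Set ℝ) (a : Fin (n + 1) → ℕ) : Set (JetCoord n r) :=
  {p ∈ contactSet n r T | IsAdapted ℝ (lineJet p.2) (orders a)}

theorem isSubmanifoldOfCodim_contactTypeSet {T : Set ℝ} (hT : IsOpen T) (ha : StrictMono a)
    (ha₁ : 1 ≤ a 0) (hr : a (Fin.last n) ≤ r) :
    IsSubmanifoldOfCodim (contactTypeSet n r T a) (r + Fintype.card (TypeEqIdx a)) := by
  have hcard : IsSubmanifoldOfCodim (contactTypeSet n r T a)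
      (Fintype.card (Fin r ⊕ TypeEqIdx a)) := by
    refine isSubmanifoldOfCodim_of_equations fun p ⟨⟨hpT, hw⟩, hp⟩ => ?_
    let f (q : JetCoord n r) : Fin r ⊕ TypeEqIdx a → ℝ :=
      Sum.elim (fun k => contactEq q.2 k) (typeEq a q.2)
    have hf : ContDiff ℝ ∞ f := contDiff_pi.2 fun
      | .inl k => (contDiff_contactEq k).comp contDiff_snd
      | .inr q => (contDiff_typeEq a q).comp contDiff_snd
    have hdet : Continuous fun q : JetCoord n r =>
        (frameMatrix (lineJet q.2) (orders a)).det :=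
      ((contDiff_det (contDiff_frameMatrix_lineJet a)).comp contDiff_snd).continuous
    refine ⟨{q | q.1 ∈ T ∧ (frameMatrix (lineJet q.2) (orders a)).det ≠ 0}, f,
      (hT.preimage continuous_fst).inter (isOpen_ne_fun hdet continuous_const),
      ⟨hpT, hp.isUnit_det_frameMatrix.ne_zero⟩, hf, ?_, ?_⟩
    · refine surjective_fderiv_of_hasDerivAt_line (hf.differentiable (by simp) p) fun η => ?_
      obtain ⟨δ, hζ, hη⟩ := exists_contactLin_eq_and_typeEq_eq ha ha₁ hr hw hp
        (fun k => if h : k < r then η (.inl ⟨k, h⟩) else 0) fun q => η (.inr q)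
      refine ⟨(0, δ), hasDerivAt_pi.2 ?_⟩
      rintro (k | q)
      · simpa [f, hζ k k.2] using hasDerivAt_contactEq p.2 δ k
      · simpa [f, hη] using
          ((hasDerivAt_id (0 : ℝ)).mul_const (η (.inr q))).const_add (typeEq a p.2 q)
    · ext q
      simp only [contactTypeSet, contactSet, f, Set.mem_inter_iff, Set.mem_ofPred_eq, funext_iff,
        Sum.forall, Sum.elim_inl, Sum.elim_inr, Pi.zero_apply, Fin.forall_iff]
      have har : a 0 ≤ r := orders_le ha hr 1
      constructor
      · rintro ⟨⟨⟨hqT, hqw⟩, hq⟩, -, hqdet⟩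
        exact ⟨⟨hqT, hqdet⟩, hqw, (isAdapted_lineJet_iff ha ha₁ har hqw hqdet.isUnit).1 hq⟩
      · rintro ⟨⟨hqT, hqdet⟩, hqw, hq⟩
        exact ⟨⟨⟨hqT, hqw⟩, (isAdapted_lineJet_iff ha ha₁ har hqw hqdet.isUnit).2 hq⟩, hqT, hqdet⟩
  simpa only [Fintype.card_sum, Fintype.card_fin] using hcard

end TypeEquations

section Realization

variable {n r : ℕ}

theorem iteratedDeriv_dotProduct {ι : Type*} [Fintype ι] {f g : ℝ → ι → ℝ} {s : ℝ} {k : ℕ}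
    (hf : ContDiffAt ℝ k f s) (hg : ContDiffAt ℝ k g s) :
    iteratedDeriv k (fun t => f t ⬝ᵥ g t) s = ∑ i ∈ Finset.range (k + 1),
      (k.choose i : ℝ) * (iteratedDeriv i f s ⬝ᵥ iteratedDeriv (k - i) g s) := by
  have hcoord {h : ℝ → ι → ℝ} (hh : ContDiffAt ℝ k h s) (j : ι) {i : ℕ} (hi : i ≤ k) :
      iteratedDeriv i (fun t => h t j) s = iteratedDeriv i h s j :=
    iteratedDeriv_clm_comp (ContinuousLinearMap.proj j) (hh.of_le (by exact_mod_cast hi))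
  have hfj := contDiffAt_pi.1 hf
  have hgj := contDiffAt_pi.1 hg
  simp only [dotProduct, Finset.mul_sum]
  rw [iteratedDeriv_fun_sum fun j _ => (hfj j).mul (hgj j), Finset.sum_comm]
  refine Finset.sum_congr rfl fun j _ => ?_
  rw [iteratedDeriv_fun_mul (hfj j) (hgj j)]
  refine Finset.sum_congr rfl fun i hi => ?_
  rw [hcoord hf j (Finset.mem_range_succ_iff.1 hi), hcoord hg j (Nat.sub_le k i), mul_assoc]

/-- The value on the velocity of the curve `v` of the contact form `dz + ∑ y_j dx_j` whose kernel is
the straightened pseudo-contact distribution. -/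
noncomputable def contactForm (v : ℝ → Coord n) (s : ℝ) : ℝ :=
  zPart (deriv v s) + yPart (v s) ⬝ᵥ xPart (deriv v s)

theorem contDiff_contactForm {v : ℝ → Coord n} (hv : ContDiff ℝ ∞ v) :
    ContDiff ℝ ∞ (contactForm v) := by
  have hv' : ContDiff ℝ ∞ (deriv v) := (contDiff_infty_iff_deriv.1 hv).2
  refine (zPart.contDiff.comp hv').add (ContDiff.sum fun j _ => ?_)
  exact (contDiff_pi.1 (yPart.contDiff.comp hv) j).mul (contDiff_pi.1 (xPart.contDiff.comp hv') j)

theorem contactEq_curveJet {v : ℝ → Coord n} {s : ℝ} (hv : ContDiffAt ℝ ∞ v s) {k : ℕ}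
    (hk : k < r) : contactEq (curveJet r v s) k = iteratedDeriv k (contactForm v) s := by
  have hle : (k : ℕ∞ω) ≤ ∞ := by exact_mod_cast le_top
  have hv' := contDiffAt_deriv hv
  have hz : ContDiffAt ℝ k (fun t => zPart (deriv v t)) s :=
    (zPart.contDiff.contDiffAt.comp s hv').of_le hle
  have hy : ContDiffAt ℝ k (fun t => yPart (v t)) s :=
    (yPart.contDiff.contDiffAt.comp s hv).of_le hle
  have hx : ContDiffAt ℝ k (fun t => xPart (deriv v t)) s :=
    (xPart.contDiff.contDiffAt.comp s hv').of_le hle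
  have hyx : ContDiffAt ℝ k (fun t => yPart (v t) ⬝ᵥ xPart (deriv v t)) s :=
    ContDiffAt.sum fun j _ => (contDiffAt_pi.1 hy j).mul (contDiffAt_pi.1 hx j)
  unfold contactForm
  rw [iteratedDeriv_fun_add hz hyx, iteratedDeriv_dotProduct hy hx,
    iteratedDeriv_clm_deriv_eq_jetAt zPart hv hk]
  refine congrArg _ (Finset.sum_congr rfl fun i hi => ?_)
  have hik : i ≤ k := Finset.mem_range_succ_iff.1 hi
  rw [iteratedDeriv_clm_comp_eq_jetAt yPart hv (r := r) (by omega),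
    iteratedDeriv_clm_deriv_eq_jetAt xPart hv (r := r) (by omega)]
  rfl

theorem exists_contDiff_primitive {F : ℝ → ℝ} (hF : ContDiff ℝ ∞ F) (s₀ : ℝ) :
    ∃ G : ℝ → ℝ, ContDiff ℝ ∞ G ∧ G s₀ = 0 ∧ ∀ s, HasDerivAt G (F s) s := by
  have hG (s : ℝ) : HasDerivAt (fun s => ∫ t in s₀..s, F t) (F s) s :=
    (hF.continuous.integral_hasStrictDerivAt s₀ s).hasDerivAt
  refine ⟨_, contDiff_infty_iff_deriv.2 ⟨fun s => (hG s).differentiableAt, ?_⟩,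
    intervalIntegral.integral_same, hG⟩
  rwa [funext fun s => (hG s).deriv]

theorem contactForm_sub_smul {v : ℝ → Coord n} {h : ℝ → ℝ} {e : Coord n} {h' s : ℝ}
    (hv : DifferentiableAt ℝ v s) (hh : HasDerivAt h h' s) (hx : xPart e = 0) (hy : yPart e = 0)
    (hz : zPart e = 1) : contactForm (fun t => v t - h t • e) s = contactForm v s - h' := by
  rw [contactForm, (hv.hasDerivAt.fun_sub (hh.smul_const e)).deriv, contactForm]
  simp only [map_sub, map_smul, hx, hy, hz, smul_zero, sub_zero, smul_eq_mul, mul_one]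
  ring

/-- The Taylor curve of `w` becomes integral when the primitive of its contact form is subtracted
from the coordinate `z`; the contact equations say that this primitive has vanishing `r`-jet. -/
theorem exists_contactForm_eq_zero {w : Fin (r + 1) → Coord n} (hw : ∀ k < r, contactEq w k = 0)
    (s₀ : ℝ) :
    ∃ v : ℝ → Coord n, ContDiff ℝ ∞ v ∧ (∀ s, contactForm v s = 0) ∧ curveJet r v s₀ = w := by
  set P := taylorCurve w s₀ with hPdef
  have hP : ContDiff ℝ ∞ P := contDiff_taylorCurve w s₀
  obtain ⟨h, hh, hh0, hderiv⟩ := exists_contDiff_primitive (contDiff_contactForm hP) s₀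
  obtain ⟨e, hxe, hye, hze⟩ := exists_coord (n := n) 0 0 1
  have hjet (k : ℕ) (hk : k ≤ r) : iteratedDeriv k h s₀ = 0 := by
    cases k with
    | zero => rw [iteratedDeriv_zero, hh0]
    | succ k =>
      rw [iteratedDeriv_succ', funext fun s => (hderiv s).deriv,
        ← contactEq_curveJet hP.contDiffAt hk, hPdef, curveJet_taylorCurve, hw k hk]
  refine ⟨fun t => P t - h t • e, hP.sub (hh.smul contDiff_const), fun s => ?_, ?_⟩
  · rw [contactForm_sub_smul (hP.differentiable (by simp) s) (hderiv s) hxe hye hze, sub_self]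
  · rw [← curveJet_taylorCurve w s₀, ← hPdef]
    funext k
    have hk : ((k : ℕ) : ℕ∞ω) ≤ ∞ := by exact_mod_cast le_top
    have hhk : ContDiffAt ℝ (k : ℕ) h s₀ := hh.contDiffAt.of_le hk
    have hhe : ContDiffAt ℝ (k : ℕ) (fun t => h t • e) s₀ := hhk.smul contDiffAt_const
    rw [curveJet, iteratedDeriv_fun_sub (hP.contDiffAt.of_le hk) hhe,
      iteratedDeriv_smul_const hhk, hjet k (Nat.lt_succ_iff.1 k.2), zero_smul, sub_zero, curveJet]

end Realization

section Nonempty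

variable {n r : ℕ} {a : Fin (n + 1) → ℕ}

theorem isAdapted_of_apply_eq_single {m : ℕ} {K : Type*} [Field K] {v : ℕ → Fin m → K}
    {b : Fin m → ℕ} (hb : StrictMono b) {N : ℕ} (hN : ∀ j, b j ≤ N)
    (hv : ∀ c ≤ N, ∀ i, v c i = if c = b i then 1 else 0) : IsAdapted K v b := by
  have hvb : v ∘ b = fun j => Pi.single j 1 := by
    funext j i
    rw [Function.comp_apply, hv _ (hN j), Pi.single_apply]
    exact if_congr (hb.injective.eq_iff.trans eq_comm) rfl rfl
  refine ⟨hvb ▸ Pi.linearIndependent_single_one (Fin m) K, fun j c hc => ?_⟩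
  by_cases hcb : ∃ i, b i = c
  · obtain ⟨i, rfl⟩ := hcb
    exact Submodule.subset_span ⟨i, hb.lt_iff_lt.1 hc, rfl⟩
  · have hzero : v c = 0 := funext fun i =>
      (hv c (hc.le.trans (hN j)) i).trans (if_neg fun h => hcb ⟨i, h.symm⟩)
    exact hzero ▸ Submodule.zero_mem _

/-- The coordinates `x_i = t ^ a_i / a_i!` and `z = t ^ a_{n+1} / a_{n+1}!` have the prescribed
type; `y_1` is the multiple of `t ^ (a_{n+1} - a_1)` for which `dz + y_1 dx_1 = 0`. -/
theorem exists_contactEq_eq_zero_and_isAdapted (hn : 1 ≤ n) (ha : StrictMono a) (ha₁ : 1 ≤ a 0)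
    (hr : a (Fin.last n) ≤ r) :
    ∃ w : Fin (r + 1) → Coord n, (∀ k < r, contactEq w k = 0) ∧
      IsAdapted ℝ (lineJet w) (orders a) := by
  obtain ⟨m, rfl⟩ := Nat.exists_eq_add_of_le' hn
  have hlast : a 0 ≤ a (Fin.last (m + 1)) := ha.monotone (Fin.zero_le _)
  let d : ℕ := a (Fin.last (m + 1)) - a 0
  let X (k : ℕ) (j : Fin (m + 1)) : ℝ := if k = a j.castSucc then 1 else 0
  let Y : ℕ → Fin (m + 1) → ℝ :=
    Pi.single d (Pi.single 0 (-((a (Fin.last (m + 1)) - 1).choose d : ℝ)⁻¹))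
  let Z (k : ℕ) : ℝ := if k = a (Fin.last (m + 1)) then 1 else 0
  obtain ⟨w, hw⟩ := exists_jet r X Y Z
  refine ⟨w, fun k hk => ?_, ?_⟩
  · have hpairing : leibnizPairing Y X k = -Z (k + 1) := by
      have hchoose : ((a (Fin.last (m + 1)) - 1).choose d : ℝ) ≠ 0 :=
        Nat.cast_ne_zero.2 (Nat.choose_pos (by omega)).ne'
      have hX (c : ℕ) : X c 0 = if c = a 0 then 1 else 0 := rfl
      have hZ (c : ℕ) : Z c = if c = a (Fin.last (m + 1)) then 1 else 0 := rfl
      rw [leibnizPairing_single_left, single_dotProduct, hX, hZ]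
      by_cases hk' : k + 1 = a (Fin.last (m + 1))
      · rw [if_pos hk', if_pos (by omega), Nat.eq_sub_of_add_eq hk']
        field_simp
      · rw [if_neg hk']
        rcases lt_or_ge k d with hkd | hkd
        · simp [Nat.choose_eq_zero_of_lt hkd]
        · simp [show k - d + 1 ≠ a 0 by omega]
    rw [contactEq, (hw _ hk).2.2, leibnizPairing_congr (fun i hi => (hw i (by omega)).2.1)
      fun i _ hi => (hw i (by omega)).1, hpairing, add_neg_cancel]
  · refine isAdapted_of_apply_eq_single (strictMono_orders ha ha₁) (orders_le ha hr)
      fun c hc i => ?_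
    refine congrFun (homogVec_eq_iff.2 ⟨?_, fun j => ?_, ?_⟩ :
      lineJet w c = fun i => if c = orders a i then 1 else 0) i
    · rfl
    · exact congrFun (hw c hc).1 j
    · exact (hw c hc).2.2

end Nonempty

section ChartImages

variable {n r : ℕ}

theorem xPart_straighten (x : Coord n) : xPart (straighten x) = xPart x :=
  funext fun j => straighten_lineIdx x j.castSucc

theorem zPart_straighten (x : Coord n) : zPart (straighten x) = zPart x :=
  straighten_lineIdx x (Fin.last n)

theorem lineVec_straighten (g : GL (Fin (n + 2)) ℝ) (x : Coord n) :
    lineVec g (straighten x) = lineVec g x := by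
  have hhomog : homogVec 1 (straighten x) = homogVec 1 x :=
    homogVec_eq_iff.2 ⟨rfl, congrFun (xPart_straighten x), zPart_straighten x⟩
  rw [lineVec_eq_mulVec, lineVec_eq_mulVec, hhomog]

theorem deriv_mem_pseudoContact_iff (g : GL (Fin (n + 2)) ℝ) {u : ℝ → Coord n} {s : ℝ}
    (hu : DifferentiableAt ℝ u s) :
    deriv u s ∈ pseudoContact g (u s) ↔ contactForm (straighten ∘ u) s = 0 := by
  have hv : DifferentiableAt ℝ (straighten ∘ u) s :=
    (contDiff_straighten.differentiable (by simp) _).comp s hu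
  have hderiv {V : Type} [NormedAddCommGroup V] [NormedSpace ℝ V] {L : Coord n →L[ℝ] V}
      (hL : ∀ x, L (straighten x) = L x) : L (deriv (straighten ∘ u) s) = L (deriv u s) := by
    have hcomp := L.hasFDerivAt.comp_hasDerivAt s hv.hasDerivAt
    rw [show L ∘ straighten ∘ u = L ∘ u from funext fun t => hL (u t)] at hcomp
    exact hcomp.unique (L.hasFDerivAt.comp_hasDerivAt s hu.hasDerivAt)
  rw [mem_pseudoContact_iff_straighten, contactForm, hderiv xPart_straighten,
    hderiv zPart_straighten, Function.comp_apply]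

/-- The change of coordinates of the jet space induced by `straighten`. -/
noncomputable def straightenJet (n r : ℕ) : JetCoord n r → JetCoord n r :=
  Prod.map id (prolong r straighten)

theorem IsSubmanifoldOfCodim.preimage_straightenJet {S : Set (JetCoord n r)} {m : ℕ}
    (h : IsSubmanifoldOfCodim S m) : IsSubmanifoldOfCodim (straightenJet n r ⁻¹' S) m := by
  have hsmooth : ContDiff ℝ ∞ (straightenJet n r) :=
    contDiff_id.prodMap (contDiff_prolong contDiff_straighten)
  have hinv : ContDiff ℝ ∞ (Prod.map id (prolong r unstraighten) : JetCoord n r → JetCoord n r) :=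
    contDiff_id.prodMap (contDiff_prolong contDiff_unstraighten)
  refine h.preimage hsmooth fun x => surjective_fderiv_of_rightInverse
    (hsmooth.differentiable (by simp) x) (hinv.differentiable (by simp) _) ?_ fun y => ?_
  · exact Prod.ext rfl (leftInverse_prolong contDiff_straighten contDiff_unstraighten
      unstraighten_straighten x.2)
  · exact Prod.ext rfl (leftInverse_prolong contDiff_unstraighten contDiff_straighten
      straighten_unstraighten y.2)

variable {I : Type*} [TopologicalSpace I] [ChartedSpace ℝ I] {Γ : I → CompleteFlag n}
  {κ : OpenPartialHomeomorph I ℝ} {g : GL (Fin (n + 2)) ℝ} {u : ℝ → Coord n} {W : Set ℝ} {t : I}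
  {a : Fin (n + 1) → ℕ}

theorem IsLocalExpr.straightenJet_eq (h : IsLocalExpr Γ κ g u W) {s : ℝ} (hs : s ∈ W) :
    straightenJet n r (s, curveJet r u s) = (s, curveJet r (straighten ∘ u) s) :=
  Prod.ext rfl (prolong_curveJet contDiff_straighten (h.contDiffAt hs))

theorem exists_isIntegralNear_of_contactForm_eq_zero (hκ : κ ∈ atlas ℝ I)
    (g : GL (Fin (n + 2)) ℝ) {v : ℝ → Coord n} (hv : ContDiff ℝ ∞ v)
    (hcontact : ∀ s, contactForm v s = 0) {s : ℝ} (hs : s ∈ κ.target) :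
    ∃ c : CurveAt I n, c.t = κ.symm s ∧ IsIntegralNear c.Γ c.t ∧
      IsLocalExpr c.Γ κ g (unstraighten ∘ v) κ.target := by
  have hu : ContDiff ℝ ∞ (unstraighten ∘ v) := contDiff_unstraighten.comp hv
  have hexpr : IsLocalExpr (fun p => chartFlag g (unstraighten (v (κ p)))) κ g
      (unstraighten ∘ v) κ.target :=
    { mem_atlas := hκ
      isOpen := κ.open_target
      subset := le_rfl
      smooth := hu.contDiffOn
      expr := fun s hs => by
        rw [κ.right_inv hs]
        exact isChartCoord_chartFlag _ _ }
  have hst : κ (κ.symm s) ∈ κ.target := by rwa [κ.right_inv hs]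
  refine ⟨⟨κ.symm s, _, κ, g, _, _, hexpr, κ.map_target hs, hst⟩, rfl,
    ⟨κ, g, _, _, hexpr, κ.map_target hs, hst, fun s _ => ?_⟩, hexpr⟩
  rw [deriv_mem_pseudoContact_iff g (hu.differentiable (by simp) s), ← Function.comp_assoc,
    Function.RightInverse.comp_eq_id (straighten_unstraighten (n := n))]
  exact hcontact s

theorem exists_isIntegralNear_of_mem_contactSet (hκ : κ ∈ atlas ℝ I) (g : GL (Fin (n + 2)) ℝ)
    {x : JetCoord n r} (hx : straightenJet n r x ∈ contactSet n r κ.target) :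
    ∃ c : CurveAt I n, IsIntegralNear c.Γ c.t ∧ ∃ u, IsLocalExpr c.Γ κ g u κ.target ∧
      c.t ∈ κ.source ∧ κ c.t ∈ κ.target ∧ x = (κ c.t, curveJet r u (κ c.t)) := by
  obtain ⟨s, w⟩ := x
  obtain ⟨hs, hw⟩ := hx
  obtain ⟨v, hv, hcontact, hjet⟩ := exists_contactForm_eq_zero hw s
  obtain ⟨c, hc, hintegral, hexpr⟩ :=
    exists_isIntegralNear_of_contactForm_eq_zero hκ g hv hcontact hs
  have hκc : κ c.t = s := hc ▸ κ.right_inv hs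
  refine ⟨c, hintegral, _, hexpr, hc ▸ κ.map_target hs, hκc ▸ hs, ?_⟩
  rw [hκc, ← prolong_curveJet contDiff_unstraighten hv.contDiffAt, hjet]
  exact Prod.ext rfl (leftInverse_prolong contDiff_straighten contDiff_unstraighten
    unstraighten_straighten w).symm

theorem typeJets_subset_integralJets : typeJets I n r a ⊆ integralJets I n r :=
  fun _ ⟨c, hj, hintegral, _⟩ => ⟨c, hj, hintegral⟩

theorem sum_succ_eq_schubertNumber_sub (a : Fin (n + 1) → ℕ) :
    ∑ i : Fin n, ((a i.succ : ℤ) - ((i : ℕ) + 2 : ℤ)) = schubertNumber a - ((a 0 : ℤ) - 1) := by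
  rw [schubertNumber, Fin.sum_univ_succ, Fin.val_zero, Nat.cast_zero, zero_add,
    add_sub_cancel_left]
  refine Finset.sum_congr rfl fun i _ => ?_
  push_cast [Fin.val_succ]
  ring

variable [IsManifold 𝓘(ℝ, ℝ) ∞ I]

theorem IsIntegralNear.contactEq_curveJet_eq_zero (hΓ : IsIntegralNear Γ t)
    (h : IsLocalExpr Γ κ g u W) (ht : t ∈ κ.source) (hm : κ t ∈ W) {k : ℕ} (hk : k < r) :
    contactEq (curveJet r (straighten ∘ u) (κ t)) k = 0 := by
  have hform : contactForm (straighten ∘ u) =ᶠ[nhds (κ t)] 0 := by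
    filter_upwards [hΓ.eventually_mem_pseudoContact h ht hm, h.isOpen.mem_nhds hm] with s hs hsW
    exact (deriv_mem_pseudoContact_iff g ((h.contDiffAt hsW).differentiableAt (by simp))).1 hs
  rw [contactEq_curveJet (contDiff_straighten.contDiffAt.comp _ (h.contDiffAt hm)) hk,
    hform.iteratedDeriv_eq]
  simp [Pi.zero_def]

theorem IsLocalExpr.projIsOfType_iff (h : IsLocalExpr Γ κ g u W) (ha : StrictMono a)
    (ha₁ : 1 ≤ a 0) (hr : a (Fin.last n) ≤ r) (ht : t ∈ κ.source) (hm : κ t ∈ W) :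
    ProjIsOfType Γ t a ↔
      IsAdapted ℝ (lineJet (curveJet r (straighten ∘ u) (κ t))) (orders a) := by
  have hline : lineVec g ∘ straighten ∘ u = lineVec g ∘ u := funext fun s => lineVec_straighten g _
  rw [h.isLift.projIsOfType_iff ht hm, ← hline]
  exact isOfType_lineVec_iff g ha ha₁ hr
    (contDiff_straighten.contDiffAt.comp _ (h.contDiffAt hm))

theorem chartImage_integralJets (hκ : κ ∈ atlas ℝ I) (g : GL (Fin (n + 2)) ℝ) :
    chartImage (integralJets I n r) κ g = straightenJet n r ⁻¹' contactSet n r κ.target := by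
  ext x
  constructor
  · rintro ⟨c, ⟨c', hjet, hintegral⟩, hcoord⟩
    obtain ⟨u, W, h, ht, hm, rfl⟩ := ((Quotient.exact hjet).2 κ g x).2 hcoord
    rw [Set.mem_preimage]
    exact h.straightenJet_eq hm ▸
      ⟨h.subset hm, fun k hk => hintegral.contactEq_curveJet_eq_zero h ht hm hk⟩
  · intro hx
    obtain ⟨c, hintegral, u, h, ht, hm, hxc⟩ := exists_isIntegralNear_of_mem_contactSet hκ g hx
    exact ⟨c, ⟨c, rfl, hintegral⟩, u, _, h, ht, hm, hxc⟩

theorem chartImage_typeJets (ha : StrictMono a) (ha₁ : 1 ≤ a 0) (hr : a (Fin.last n) ≤ r)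
    (hκ : κ ∈ atlas ℝ I) (g : GL (Fin (n + 2)) ℝ) :
    chartImage (typeJets I n r a) κ g = straightenJet n r ⁻¹' contactTypeSet n r κ.target a := by
  ext x
  constructor
  · rintro ⟨c, ⟨c', hjet, hintegral, htype⟩, hcoord⟩
    obtain ⟨u, W, h, ht, hm, rfl⟩ := ((Quotient.exact hjet).2 κ g x).2 hcoord
    rw [Set.mem_preimage]
    exact h.straightenJet_eq hm ▸
      ⟨⟨h.subset hm, fun k hk => hintegral.contactEq_curveJet_eq_zero h ht hm hk⟩,
        (h.projIsOfType_iff ha ha₁ hr ht hm).1 htype⟩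
  · rintro ⟨hcontact, hadapted⟩
    obtain ⟨c, hintegral, u, h, ht, hm, rfl⟩ :=
      exists_isIntegralNear_of_mem_contactSet hκ g hcontact
    rw [h.straightenJet_eq hm] at hadapted
    exact ⟨c, ⟨c, rfl, hintegral, (h.projIsOfType_iff ha ha₁ hr ht hm).2 hadapted⟩,
      u, _, h, ht, hm, rfl⟩

theorem isJetSubmanifold_integralJets : IsJetSubmanifold (integralJets I n r) r := by
  intro κ hκ g
  rw [chartImage_integralJets hκ g]
  exact (isSubmanifoldOfCodim_contactSet κ.open_target).preimage_straightenJet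

theorem isJetSubmanifold_typeJets (ha : StrictMono a) (ha₁ : 1 ≤ a 0)
    (hr : a (Fin.last n) ≤ r) :
    IsJetSubmanifold (typeJets I n r a) (r + Fintype.card (TypeEqIdx a)) := by
  intro κ hκ g
  rw [chartImage_typeJets ha ha₁ hr hκ g]
  exact (isSubmanifoldOfCodim_contactTypeSet κ.open_target ha ha₁ hr).preimage_straightenJet

theorem typeJets_nonempty [Nonempty I] (hn : 1 ≤ n) (ha : StrictMono a) (ha₁ : 1 ≤ a 0)
    (hr : a (Fin.last n) ≤ r) : (typeJets I n r a).Nonempty := by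
  obtain ⟨t⟩ := ‹Nonempty I›
  obtain ⟨w, hw, hadapted⟩ := exists_contactEq_eq_zero_and_isAdapted hn ha ha₁ hr
  have hmem : ((chartAt ℝ t t, prolong r unstraighten w) : JetCoord n r) ∈
      chartImage (typeJets I n r a) (chartAt ℝ t) 1 := by
    rw [chartImage_typeJets ha ha₁ hr (chart_mem_atlas ℝ t), Set.mem_preimage, straightenJet,
      Prod.map_apply, leftInverse_prolong contDiff_unstraighten contDiff_straighten
        straighten_unstraighten w]
    exact ⟨⟨mem_chart_target ℝ t, hw⟩, hadapted⟩
  obtain ⟨c, hc, -⟩ := hmem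
  exact ⟨c.jet r, hc⟩

end ChartImages

end FlagJet

theorem mainTheorem2 {I : Type*} [TopologicalSpace I] [ChartedSpace ℝ I]
    [IsManifold 𝓘(ℝ, ℝ) ∞ I] [Nonempty I]
    (n : ℕ) (hn : 1 ≤ n) (a : Fin (n + 1) → ℕ) (ha : StrictMono a) (ha₁ : 1 ≤ a 0)
    (r : ℕ) (hr : a (Fin.last n) ≤ r) :
    (FlagJet.typeJets I n r a).Nonempty ∧
    FlagJet.HasCodimIn (FlagJet.typeJets I n r a) (FlagJet.integralJets I n r)
      (∑ i : Fin n, ((a i.succ : ℤ) - ((i : ℕ) + 2 : ℤ))) ∧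
    (∑ i : Fin n, ((a i.succ : ℤ) - ((i : ℕ) + 2 : ℤ))) =
      FlagJet.schubertNumber a - ((a 0 : ℤ) - 1) := by
  refine ⟨FlagJet.typeJets_nonempty hn ha ha₁ hr,
    ⟨FlagJet.typeJets_subset_integralJets, r, r + Fintype.card (FlagJet.TypeEqIdx a),
      FlagJet.isJetSubmanifold_integralJets, FlagJet.isJetSubmanifold_typeJets ha ha₁ hr, ?_⟩,
    FlagJet.sum_succ_eq_schubertNumber_sub a⟩
  rw [← FlagJet.card_typeEqIdx ha ha₁]
  push_cast
  ring
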